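/- Fix integers $1\le M\le N$ and real numbers $\alpha,\eta,\theta\ge 0$, not all zero. Put $L_t=M-|t|$ for $-M\le t\le 0$ and $L_t=\min(N-t,M)$ for $0<t\le N$. *Discrete process.* For $0<q<1$ and $a>0$ with $a\,q^{(\eta+\theta)/2}<1$, let $\Lambda=(\Lambda_{i,j})_{1\le i\le M,\,1\le j\le N}$ be a random plane partition (an array of non-negative integers, non-increasing along rows and columns) with $$\mathbb P(\Lambda)\ \propto\ q^{\eta\sum_{t=-M}^{-1}|\lambda^{(t)}|}\,\bigl(a\,q^{(\eta+\theta)/2}\bigr)^{|\lambda^{(0)}|}\,q^{\theta\sum_{t=1}^{N}|\lambda^{(t)}|},$$ where $\lambda^{(t)}=(\Lambda_{k+|t|,k})_{k\ge1}$ for $t\le 0$, $\lambda^{(t)}=(\Lambda_{k,k+t})_{k\ge 1}$ for $t>0$ (a partition with at most $L_t$ parts), and $|\lambda|=\sum_k\lambda_k$. Let $l^{(t)}_i=\lambda^{(t)}_i+M-i$ for $1\le i\le L_t$, $-M+1\le t\le N-1$. *Theorem.* Let $q=e^{-\epsilon}$ and $a=e^{-\alpha\epsilon}$. For every $\epsilon>0$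 the above probability measure is well defined. There is a process $\mathbf X=(\mathbf x^{(t)})_{-M+1\le t\le N-1}$, with $\mathbf x^{(t)}=(x^{(t)}_1,\dots,x^{(t)}_{L_t})$, such that, as $\epsilon\to0+$, the process with variables $x_i$ given by $\lambda^{(t)}_i=-\log (x_i)/\epsilon$, i.e. $(e^{-\epsilon\lambda^{(t)}_i})_{t,i}$, and equally the process $(e^{-\epsilon l^{(t)}_i})_{t,i}$, converges to $\mathbf X$ in the sense of weak convergence of finite-dimensional distributions. Moreover: 1. Almost surely, $0<x^{(t)}_1<\dots<x^{(t)}_{L_t}<1$ for every $t$, and $$\emptyset\prec\mathbf x^{(-M+1)}\prec\cdots\prec\mathbf x^{(-1)}\prec\mathbf x^{(0)}\succ\mathbf x^{(1)}\succ\cdots\succ\mathbf x^{(N-1)}\succ\emptyset ,$$ where $\mathbf y\prec\mathbf x$ means that $\mathbf y$ has as many entries as $\mathbf x$ or one entry less, and $x_1<y_1<x_2<y_2<\cdots$ (all the inequalities between existing entries). 2. For each $-M+1\le t\le N-1$ the law of $\mathbf x^{(t)}$ is absolutely continuous on $\{0<x_1<\dots<x_{L_t}<1\}$ with density proportional to $$\prod_{1\le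 i<j\le L_t}(x_j^\eta-x_i^\eta)(x_j^\theta-x_i^\theta)\prod_{1\le i\le L_t}w_c(x_i),$$ where $$w_c(x)=\begin{cases}x^{\alpha+\frac{\eta+\theta}{2}+|t|\eta-1}(1-x^\theta)^{N-(M-|t|)}&\text{if }t\le0,\\ x^{\alpha+\frac{\eta+\theta}{2}+t\theta-1}(1-x^\theta)^{N-t-M}&\text{if }t>0,\ N-t\ge M,\\ x^{\alpha+\frac{\eta+\theta}{2}+t\theta-1}(1-x^\eta)^{M-(N-t)}&\text{if }t>0,\ N-t<M.\end{cases}$$ In the degenerate cases $\eta=0$ or $\theta=0$, a difference $y^\kappa-x^\kappa$ with $\kappa\in\{\eta,\theta\}$ equal to $0$ (including $1-x^\kappa=1^\kappa-x^\kappa$) is read as $\log y-\log x$, the limit of $(y^\kappa-x^\kappa)/\kappa$ as $\kappa\to0+$. -/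

import Mathlib

open MeasureTheory ProbabilityTheory Filter Topology
open scoped ENNReal

noncomputable section

namespace MuttalibBorodin

/-- Plane partitions with base in an `M × N` rectangle, with rows and columns indexed from `0`,
the heights being non-increasing in both indices and extended by `0` off the rectangle. -/
structure PlanePartition (M N : ℕ) where
  /-- the height above the cell `(i, j)` -/
  height : ℕ → ℕ → ℕ
  anti_row : ∀ i j, height i (j + 1) ≤ height i j
  anti_col : ∀ i j, height (i + 1) j ≤ height i j
  height_eq_zero : ∀ i j, M ≤ i ∨ N ≤ j → height i j = 0

instance (M N : ℕ) : MeasurableSpace (PlanePartition M N) := ⊤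

/-- The number `L_t` of points at time `t`, for `-M ≤ t ≤ N`. -/
def len (M N : ℕ) (t : ℤ) : ℕ :=
  if t ≤ 0 then M - t.natAbs else min (N - t.natAbs) M

/-- The discrete times `-M + 1, …, N - 1`. -/
abbrev Time (M N : ℕ) : Type := {t : ℤ // -(M : ℤ) + 1 ≤ t ∧ t ≤ (N : ℤ) - 1}

namespace PlanePartition

variable {M N : ℕ} (Λ : PlanePartition M N)

/-- The diagonal slice `λ^(t)`; its part number `k` (counted from `0`). -/
def slice (t : ℤ) (k : ℕ) : ℕ :=
  if t ≤ 0 then Λ.height (k + t.natAbs) k else Λ.height k (k + t.natAbs)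

/-- The size `|λ^(t)|`. -/
def sliceSize (t : ℤ) : ℕ := ∑ k ∈ Finset.range (len M N t), Λ.slice t k

/-- The number of cubes strictly to the left of the central slice. -/
def leftVol : ℕ := ∑ t ∈ Finset.Icc (-(M : ℤ)) (-1), Λ.sliceSize t

/-- The number of cubes on the central slice. -/
def centralVol : ℕ := Λ.sliceSize 0

/-- The number of cubes strictly to the right of the central slice. -/
def rightVol : ℕ := ∑ t ∈ Finset.Icc (1 : ℤ) N, Λ.sliceSize t

/-- The unnormalized probability of a plane partition. -/
def weight (q a η θ : ℝ) : ℝ :=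
  q ^ (η * (Λ.leftVol : ℝ)) * (a * q ^ ((η + θ) / 2)) ^ Λ.centralVol
    * q ^ (θ * (Λ.rightVol : ℝ))

/-- The shifted particle positions `l^(t)_i = λ^(t)_i + M - i` with `i = k + 1`. -/
def pos (t : ℤ) (k : ℕ) : ℕ := Λ.slice t k + (M - (k + 1))

/-- The variables `x` with `λ^(t)_i = -(log x^(t)_i) / ε`. -/
def scaled (ε : ℝ) (t : Time M N) (k : Fin (len M N t)) : ℝ :=
  Real.exp (-(ε * (Λ.slice t k : ℝ)))

/-- The same change of variables, applied to the shifted positions `l^(t)_i`. -/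
def scaledPos (ε : ℝ) (t : Time M N) (k : Fin (len M N t)) : ℝ :=
  Real.exp (-(ε * (Λ.pos t k : ℝ)))

end PlanePartition

/-- `P` is the probability distribution on plane partitions that is proportional to the weight. -/
def IsPlanePartitionLaw {M N : ℕ} (q a η θ : ℝ) (P : PMF (PlanePartition M N)) : Prop :=
  ∀ Λ : PlanePartition M N, P Λ =
    ENNReal.ofReal (Λ.weight q a η θ) /
      ∑' Λ' : PlanePartition M N, ENNReal.ofReal (Λ'.weight q a η θ)

/-- Trajectories of a process with `L_t` real points at each time `t`. -/
abbrev Trajectory (M N : ℕ) : Type := (t : Time M N) → Fin (len M N t) → ℝ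

/-- The relation `y ≺ x`, that is `x_1 < y_1 < x_2 < y_2 < ⋯`, where `y` has as many entries as
`x` or one entry less. -/
def Interlace {m n : ℕ} (y : Fin m → ℝ) (x : Fin n → ℝ) : Prop :=
  (n = m ∨ n = m + 1) ∧
  (∀ (i : Fin n) (j : Fin m), (i : ℕ) = j → x i < y j) ∧
  (∀ (i : Fin n) (j : Fin m), (i : ℕ) = j + 1 → y j < x i)

/-- `∅ ≺ x^(-M+1) ≺ ⋯ ≺ x^(-1) ≺ x^(0) ≻ x^(1) ≻ ⋯ ≻ x^(N-1) ≻ ∅`. -/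
def InterlacingTrajectory {M N : ℕ} (x : Trajectory M N) : Prop :=
  (∀ t : Time M N, (t : ℤ) = -(M : ℤ) + 1 → Interlace (Fin.elim0 : Fin 0 → ℝ) (x t)) ∧
  (∀ s t : Time M N, (t : ℤ) = s + 1 → (t : ℤ) ≤ 0 → Interlace (x s) (x t)) ∧
  (∀ s t : Time M N, (t : ℤ) = s + 1 → 0 ≤ (s : ℤ) → Interlace (x t) (x s)) ∧
  (∀ t : Time M N, (t : ℤ) = (N : ℤ) - 1 → Interlace (Fin.elim0 : Fin 0 → ℝ) (x t))

/-- The difference `y ^ κ - x ^ κ`, which for `κ = 0` is read as `log y - log x`, the limit of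
`(y ^ κ - x ^ κ) / κ` as `κ → 0`. -/
def powDiff (κ y x : ℝ) : ℝ :=
  if κ = 0 then Real.log y - Real.log x else y ^ κ - x ^ κ

/-- The weight `w_c` at time `t`; here `powDiff κ 1 x` is `1 - x ^ κ` (for `κ ≠ 0`). -/
def weightC (M N : ℕ) (α η θ : ℝ) (t : ℤ) (x : ℝ) : ℝ :=
  if t ≤ 0 then
    x ^ (α + (η + θ) / 2 + (t.natAbs : ℝ) * η - 1) * powDiff θ 1 x ^ (N - (M - t.natAbs))
  else if M ≤ N - t.natAbs then
    x ^ (α + (η + θ) / 2 + (t : ℝ) * θ - 1) * powDiff θ 1 x ^ (N - t.natAbs - M)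
  else
    x ^ (α + (η + θ) / 2 + (t : ℝ) * θ - 1) * powDiff η 1 x ^ (M - (N - t.natAbs))

/-- The unnormalized Muttalib--Borodin density at time `t`. -/
def mbDensity (M N : ℕ) (α η θ : ℝ) (t : ℤ) (x : Fin (len M N t) → ℝ) : ℝ :=
  (∏ i, ∏ j ∈ Finset.Ioi i, powDiff η (x j) (x i) * powDiff θ (x j) (x i))
    * ∏ i, weightC M N α η θ t (x i)

/-- The increasing vectors with entries in `(0, 1)`. -/
def orderedPoints (n : ℕ) : Set (Fin n → ℝ) :=
  {x | StrictMono x ∧ ∀ i, x i ∈ Set.Ioo (0 : ℝ) 1}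

/-- The unnormalized Muttalib--Borodin measure on increasing vectors with entries in `(0, 1)`. -/
def mbMeasure (M N : ℕ) (α η θ : ℝ) (t : ℤ) : Measure (Fin (len M N t) → ℝ) :=
  (volume.restrict (orderedPoints (len M N t))).withDensity
    fun x => ENNReal.ofReal (mbDensity M N α η θ t x)

end MuttalibBorodin

end

open MuttalibBorodin

/-!
The weight of a plane partition is `∏ exp (-ε c_t λ)` over all its entries `λ`, where the rate
`c_t` depends only on the time `t` of the slice containing the entry: it is `η` to the left of the
centre, `θ` to the right, and `α + (η + θ) / 2 > 0` at the centre. A plane partition is an array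
of slices `λ^(t)` in which consecutive slices interlace weakly (`mem_range_slices`). In the
variables `x = exp (-ε λ)` the plane partition measure is thus a Riemann sum, on the space of
trajectories, for the density `∏ x ^ (c_t - 1)` on the set of interlacing trajectories, which is
called `chainDensity` below. The largest entry of a plane partition is a part of the central
slice, where the rate is positive, and this yields an integrable bound
(`prod_invWeight_mul_exp_le`). Dominated convergence then shows that the plane partition measures
converge to the law with density proportional to `chainDensity`, and a shift of the parts by a
bounded amount makes no difference in the limit (`tendsto_tsum_planePartition`).

The marginal at time `t` is found by integrating out the slices before `t` from left to right, and
those after `t` from right to left. With `φ x = x ^ κ - 1` (or `log x`), each step is an integral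
of a weighted Vandermonde product in the `φ (y_i)` over a box of points `y` interlacing with given
points `x`. This is a determinant of one-dimensional integrals, and since `x φ' = κ φ + B`, the
functions `x ^ c φ ^ k` are antiderivatives of the weight times a two-term polynomial in `φ`. The
determinant of boundary values is therefore again a weighted Vandermonde product, now in the
`φ (x_i)` (`lintegral_gapBox` and the four one-step integrals built on it). Constants are never
computed: it is enough that they are positive. The left side contributes the Vandermonde product
with exponent `η`, the right side the one with exponent `θ`, and the accumulated weights are
`weightC` (`exists_lintegral_mul_chainDensity`).
-/

namespace MuttalibBorodin

/-! ### The deformed logarithm and its Vandermonde product -/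

/-- The deformed logarithm `x ^ κ - 1`, read as `log x` for `κ = 0`. -/
noncomputable def powLog (κ x : ℝ) : ℝ := powDiff κ x 1

/-- The constant `B` in `x * φ' = κ * φ + B`, where `φ = powLog κ`. -/
noncomputable def powLogSlope (κ : ℝ) : ℝ := if κ = 0 then 1 else κ

/-- The Vandermonde product `∏_{i < j} (x_j ^ κ - x_i ^ κ)`, with differences of logarithms for
`κ = 0`. -/
noncomputable def vdm (κ : ℝ) {n : ℕ} (x : Fin n → ℝ) : ℝ :=
  ∏ i, ∏ j ∈ Finset.Ioi i, powDiff κ (x j) (x i)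

lemma powDiff_eq_sub (κ y x : ℝ) : powDiff κ y x = powLog κ y - powLog κ x := by
  unfold powLog powDiff
  split_ifs <;> ring

lemma powDiff_one_left (κ x : ℝ) : powDiff κ 1 x = -powLog κ x := by
  unfold powLog powDiff
  split_ifs <;> ring

lemma powLog_one (κ : ℝ) : powLog κ 1 = 0 := by
  unfold powLog powDiff
  split_ifs <;> simp

lemma powDiff_pos {κ x y : ℝ} (hκ : 0 ≤ κ) (hx : 0 < x) (hxy : x < y) : 0 < powDiff κ y x := by
  unfold powDiff
  split_ifs with h
  · exact sub_pos.2 (Real.log_lt_log hx hxy)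
  · exact sub_pos.2 (Real.rpow_lt_rpow hx.le hxy (lt_of_le_of_ne hκ (Ne.symm h)))

lemma powLogSlope_pos {κ : ℝ} (hκ : 0 ≤ κ) : 0 < powLogSlope κ := by
  unfold powLogSlope
  split_ifs with h
  · exact one_pos
  · exact lt_of_le_of_ne hκ (Ne.symm h)

lemma vdm_eq_det (κ : ℝ) {n : ℕ} (x : Fin n → ℝ) :
    vdm κ x = (Matrix.vandermonde fun i => powLog κ (x i)).det := by
  simp only [vdm, Matrix.det_vandermonde, powDiff_eq_sub]

lemma vdm_pos {κ : ℝ} (hκ : 0 ≤ κ) {n : ℕ} {x : Fin n → ℝ} (hx : StrictMono x)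
    (h0 : ∀ i, 0 < x i) : 0 < vdm κ x :=
  Finset.prod_pos fun i _ => Finset.prod_pos fun _ hj =>
    powDiff_pos hκ (h0 i) (hx (Finset.mem_Ioi.1 hj))

lemma hasDerivAt_powLog (κ : ℝ) {x : ℝ} (hx : 0 < x) :
    HasDerivAt (powLog κ) (powLogSlope κ * x ^ (κ - 1)) x := by
  by_cases h : κ = 0
  · have : powLog κ = fun x => Real.log x - Real.log 1 := by
      funext y; simp [powLog, powDiff, h]
    rw [this]
    simpa [h, powLogSlope, Real.rpow_neg_one] using
      (Real.hasDerivAt_log hx.ne').sub_const (Real.log 1)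
  · have : powLog κ = fun x => x ^ κ - 1 ^ κ := by
      funext y; simp [powLog, powDiff, h]
    rw [this]
    simpa [h, powLogSlope] using
      (Real.hasDerivAt_rpow_const (p := κ) (Or.inl hx.ne')).sub_const ((1 : ℝ) ^ κ)

lemma mul_deriv_powLog (κ : ℝ) {x : ℝ} (hx : 0 < x) :
    x * (powLogSlope κ * x ^ (κ - 1)) = κ * powLog κ x + powLogSlope κ := by
  have h1 : x * x ^ (κ - 1) = x ^ κ := by
    rw [Real.rpow_sub_one hx.ne']; field_simp
  have h2 : x * (powLogSlope κ * x ^ (κ - 1)) = powLogSlope κ * x ^ κ := by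
    rw [← h1]; ring
  rw [h2]
  unfold powLogSlope powLog powDiff
  split_ifs with h
  · simp [h]
  · simp; ring

lemma continuousOn_powLog (κ : ℝ) : ContinuousOn (powLog κ) (Set.Ioi 0) := fun _ hx =>
  (hasDerivAt_powLog κ hx).continuousAt.continuousWithinAt

/-- The derivative of `x ^ c * φ ^ k` is again `x ^ (c - 1)` times a polynomial in `φ`, which is
what makes the interlacing integrals computable. -/
lemma hasDerivAt_rpow_mul_powLog_pow (c κ : ℝ) (k : ℕ) {x : ℝ} (hx : 0 < x) :
    HasDerivAt (fun x => x ^ c * powLog κ x ^ k)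
      (x ^ (c - 1) * ((c + k * κ) * powLog κ x ^ k
        + k * powLogSlope κ * powLog κ x ^ (k - 1))) x := by
  have h1 := (Real.hasDerivAt_rpow_const (p := c) (Or.inl hx.ne')).mul
    ((hasDerivAt_powLog κ hx).pow k)
  refine h1.congr_deriv ?_
  have h3 : x ^ c = x ^ (c - 1) * x := by
    rw [Real.rpow_sub_one hx.ne']; field_simp
  simp only [Pi.pow_apply]
  rw [h3]
  have h4 := mul_deriv_powLog κ hx
  rcases k with _ | k
  · simp; ring
  · simp only [Nat.add_sub_cancel, pow_succ]
    linear_combination (x ^ (c - 1) * ((k + 1 : ℕ) : ℝ) * powLog κ x ^ k) * h4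

lemma continuousOn_rpow_mul_powLog_pow {c κ : ℝ} (hc : 0 < c) (hκ : 0 ≤ κ) (k : ℕ) :
    ContinuousOn (fun x => x ^ c * powLog κ x ^ k) (Set.Ici 0) := by
  intro x hx
  rcases eq_or_lt_of_le (Set.mem_Ici.1 hx) with rfl | hx
  swap
  · exact (hasDerivAt_rpow_mul_powLog_pow c κ k hx).continuousAt.continuousWithinAt
  by_cases h : κ = 0
  · subst h
    rcases k with _ | k
    · simpa using (Real.continuousAt_rpow_const 0 c (Or.inr hc.le)).continuousWithinAt
    rw [← continuousWithinAt_sdiff_self]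
    have h0 : Set.Ici (0 : ℝ) \ {0} = Set.Ioi 0 := by
      ext y; simp [lt_iff_le_and_ne, eq_comm]
    rw [h0]
    unfold ContinuousWithinAt
    have h1 := tendsto_log_mul_rpow_nhdsGT_zero (r := c / (k + 1 : ℕ)) (by positivity)
    have h2 := h1.pow (k + 1)
    simp only [ne_eq, Nat.add_eq_zero_iff, one_ne_zero, and_false, not_false_eq_true,
      Real.zero_rpow hc.ne', zero_mul, zero_pow] at h2 ⊢
    refine h2.congr' ?_
    filter_upwards [self_mem_nhdsWithin] with y hy
    have hy : 0 < y := hy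
    rw [mul_pow, ← Real.rpow_natCast (y ^ _), ← Real.rpow_mul hy.le,
      div_mul_cancel₀ _ (by positivity), mul_comm]
    simp [powLog, powDiff]
  · have hκ' : 0 < κ := lt_of_le_of_ne hκ (Ne.symm h)
    have : (fun x => x ^ c * powLog κ x ^ k) = fun x => x ^ c * (x ^ κ - 1) ^ k := by
      funext y; simp [powLog, powDiff, h]
    rw [this]
    exact ((Real.continuousAt_rpow_const 0 c (Or.inr hc.le)).mul
      (((Real.continuousAt_rpow_const 0 κ (Or.inr hκ'.le)).sub continuousAt_const).pow
        k)).continuousWithinAt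

lemma integrableOn_rpow_mul_powLog_pow {c κ : ℝ} (hc : 0 < c) (hκ : 0 ≤ κ) (k : ℕ) :
    IntegrableOn (fun x => x ^ (c - 1) * powLog κ x ^ k) (Set.Ioo 0 1) := by
  -- `x ^ (c / 2) * φ ^ k` is bounded near `0`, and `x ^ (c / 2 - 1)` is still integrable.
  have h1 : IntegrableOn (fun x : ℝ => x ^ (c / 2 - 1)) (Set.Icc 0 1) := by
    rw [integrableOn_Icc_iff_integrableOn_Ioc, ← intervalIntegrable_iff_integrableOn_Ioc_of_le
      zero_le_one]
    exact intervalIntegral.intervalIntegrable_rpow' (by linarith)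
  have h2 : ContinuousOn (fun x => x ^ (c / 2) * powLog κ x ^ k) (Set.Icc 0 1) :=
    (continuousOn_rpow_mul_powLog_pow (half_pos hc) hκ k).mono fun y hy => hy.1
  have h3 := (h1.mul_continuousOn h2 isCompact_Icc).mono_set Set.Ioo_subset_Icc_self
  refine h3.congr_fun (fun y hy => ?_) measurableSet_Ioo
  have : y ^ (c - 1) = y ^ (c / 2 - 1) * y ^ (c / 2) := by
    rw [← Real.rpow_add hy.1]; ring_nf
  simp only [this]
  ring

/-! ### Determinants of boundary values -/

/-- A determinant of differences of consecutive rows, written as a bordered determinant. -/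
lemma det_sub_eq_det_cons_one {n : ℕ} (h : Fin n → ℝ → ℝ) (z : Fin (n + 1) → ℝ) :
    (Matrix.of fun i j : Fin n => h j (z i.succ) - h j (z i.castSucc)).det =
      (Matrix.of fun i : Fin (n + 1) =>
        (Fin.cons 1 (fun j => h j (z i)) : Fin (n + 1) → ℝ)).det := by
  have h1 := Matrix.det_eq_of_forall_row_eq_smul_add_pred
    (A := Matrix.of fun i : Fin (n + 1) => (Fin.cons 1 (fun j => h j (z i)) : Fin (n + 1) → ℝ))
    (B := Matrix.of fun i : Fin (n + 1) => (Fin.cases (Fin.cons 1 (fun j => h j (z 0)))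
      (fun i => Fin.cons 0 (fun j => h j (z i.succ) - h j (z i.castSucc))) i :
        Fin (n + 1) → ℝ)) (fun _ => 1) (fun j => by simp) (fun i j => by
          refine Fin.cases ?_ (fun j => ?_) j <;> simp)
  rw [h1, Matrix.det_succ_column_zero, Fin.sum_univ_succ]
  simp only [Matrix.of_apply, Fin.cases_succ, Fin.cons_zero, mul_zero, zero_mul,
    Finset.sum_const_zero, add_zero, Fin.val_zero, pow_zero, one_mul, Fin.cases_zero]
  congr 1

lemma det_of_first_row {n : ℕ} (A : Matrix (Fin (n + 1)) (Fin (n + 1)) ℝ)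
    (h : ∀ j : Fin n, A 0 j.succ = 0) :
    A.det = A 0 0 * (A.submatrix Fin.succ Fin.succ).det := by
  rw [Matrix.det_succ_row_zero, Fin.sum_univ_succ]
  simp [h]

lemma abs_det_of_last_row {n : ℕ} (A : Matrix (Fin (n + 1)) (Fin (n + 1)) ℝ)
    (h : ∀ j : Fin n, A (Fin.last n) j.succ = 0) :
    |A.det| = |A (Fin.last n) 0| * |(A.submatrix Fin.castSucc Fin.succ).det| := by
  rw [Matrix.det_succ_row A (Fin.last n), Fin.sum_univ_succ]
  simp [h, abs_mul]

/-! ### Integrals over boxes -/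

/-- **Andréief's identity** for boxes: integrating a determinant row by row. -/
lemma integral_det_pi {n : ℕ} (μ : Fin n → Measure ℝ) [∀ i, SigmaFinite (μ i)]
    (g : Fin n → ℝ → ℝ) (hg : ∀ i j, Integrable (g j) (μ i)) :
    Integrable (fun y : Fin n → ℝ => (Matrix.of fun i j => g j (y i)).det) (Measure.pi μ) ∧
    ∫ y, (Matrix.of fun i j => g j (y i)).det ∂(Measure.pi μ) =
      (Matrix.of fun i j => ∫ t, g j t ∂(μ i)).det := by
  have h0 : ∀ (σ : Equiv.Perm (Fin n)) (y : Fin n → ℝ),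
      ∏ i, g i (y (σ i)) = ∏ i, g (σ.symm i) (y i) := fun σ y =>
    Fintype.prod_equiv σ _ _ fun i => by simp
  have h1 : ∀ σ : Equiv.Perm (Fin n), Integrable (fun y : Fin n → ℝ =>
      ((Equiv.Perm.sign σ : ℤ) : ℝ) * ∏ i, g i (y (σ i))) (Measure.pi μ) := fun σ => by
    simp only [h0]
    exact (Integrable.fintype_prod (f := fun i t => g (σ.symm i) t) fun i => hg i _).const_mul _
  simp only [Matrix.det_apply', Matrix.of_apply]
  refine ⟨integrable_finsetSum _ fun σ _ => h1 σ, ?_⟩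
  rw [integral_finsetSum _ fun σ _ => h1 σ]
  refine Finset.sum_congr rfl fun σ _ => ?_
  have h3 : ∏ i, ∫ t, g i t ∂μ (σ i) = ∏ i, ∫ t, g (σ.symm i) t ∂μ i :=
    Fintype.prod_equiv σ _ _ fun i => by simp
  rw [integral_const_mul, h3]
  simp only [h0]
  rw [integral_fintype_prod_eq_prod (f := fun i t => g (σ.symm i) t)]

/-- The monic polynomial `X ^ j + r * X ^ (j - 1)`, and `1` for `j = 0`. -/
noncomputable def twoTerm (r : ℕ → ℝ) (j : ℕ) : Polynomial ℝ :=
  match j with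
  | 0 => 1
  | j + 1 => Polynomial.X ^ (j + 1) + Polynomial.C (r (j + 1)) * Polynomial.X ^ j

lemma degree_twoTerm_tail (r : ℝ) (j : ℕ) :
    (Polynomial.C r * Polynomial.X ^ j).degree < ((j + 1 : ℕ) : WithBot ℕ) :=
  lt_of_le_of_lt (Polynomial.degree_C_mul_X_pow_le _ _) (by exact_mod_cast Nat.lt_succ_self j)

lemma natDegree_twoTerm (r : ℕ → ℝ) (j : ℕ) : (twoTerm r j).natDegree = j := by
  rcases j with _ | j
  · simp [twoTerm]
  · simp only [twoTerm]
    exact Polynomial.natDegree_eq_of_degree_eq_some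
      ((Polynomial.degree_add_eq_left_of_degree_lt (by
        rw [Polynomial.degree_X_pow]; exact degree_twoTerm_tail _ _)).trans
          (Polynomial.degree_X_pow _))

lemma monic_twoTerm (r : ℕ → ℝ) (j : ℕ) : (twoTerm r j).Monic := by
  rcases j with _ | j
  · simp [twoTerm]
  · exact Polynomial.monic_X_pow_add (degree_twoTerm_tail _ _)

/-- The box of the `y` with `z_0 < y_0 < z_1 < y_1 < ⋯ < z_n`. -/
def gapBox {n : ℕ} (z : Fin (n + 1) → ℝ) : Set (Fin n → ℝ) :=
  Set.univ.pi fun i => Set.Ioo (z i.castSucc) (z i.succ)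

lemma strictMono_of_mem_gapBox {n : ℕ} {z : Fin (n + 1) → ℝ} (hz : Monotone z) {y : Fin n → ℝ}
    (hy : y ∈ gapBox z) : StrictMono y := fun i j hij =>
  (hy i trivial).2.trans_le ((hz (by
    rw [Fin.le_def]; simpa using Fin.lt_def.1 hij)).trans (hy j trivial).1.le)

/-- The integral of a weighted Vandermonde product over a box of interlacing points, in terms of
antiderivatives `h_j` of the weight times a monic polynomial of degree `j` in `φ`. -/
lemma lintegral_gapBox {κ a b : ℝ} (hκ : 0 ≤ κ) (ha : 0 ≤ a) {n : ℕ} {z : Fin (n + 1) → ℝ}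
    (hz : Monotone z) (hza : ∀ i, a ≤ z i) (hzb : ∀ i, z i ≤ b)
    {w : ℝ → ℝ} (hw : ∀ t ∈ Set.Ioo a b, 0 ≤ w t) (r : ℕ → ℝ) (h : Fin n → ℝ → ℝ)
    (hcont : ∀ j, ContinuousOn (h j) (Set.Icc a b))
    (hderiv : ∀ j, ∀ t ∈ Set.Ioo a b,
      HasDerivAt (h j) (w t * (twoTerm r j).eval (powLog κ t)) t)
    (hint : ∀ j : Fin n,
      IntegrableOn (fun t => w t * (twoTerm r j).eval (powLog κ t)) (Set.Ioo a b)) :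
    ∫⁻ y in gapBox z, ENNReal.ofReal (vdm κ y * ∏ i, w (y i)) =
      ENNReal.ofReal |(Matrix.of fun i j : Fin n => h j (z i.succ) - h j (z i.castSucc)).det| := by
  have hsub : ∀ i : Fin n, Set.Ioo (z i.castSucc) (z i.succ) ⊆ Set.Ioo a b := fun i =>
    Set.Ioo_subset_Ioo (hza _) (hzb _)
  have hle : ∀ i : Fin n, z i.castSucc ≤ z i.succ := fun i => hz (Fin.castSucc_le_succ i)
  have hdet : ∀ y : Fin n → ℝ, vdm κ y * ∏ i, w (y i) =
      (Matrix.of fun i j : Fin n => w (y i) * (twoTerm r j).eval (powLog κ (y i))).det := by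
    intro y
    rw [vdm_eq_det, Matrix.det_eval_matrixOfPolynomials_eq_det_vandermonde _
      (fun j : Fin n => twoTerm r j) (fun j => natDegree_twoTerm r j)
      (fun j => monic_twoTerm r j), mul_comm, ← Matrix.det_mul_column]
    rfl
  have key := integral_det_pi (fun i : Fin n => volume.restrict
    (Set.Ioo (z i.castSucc) (z i.succ))) (fun j t => w t * (twoTerm r j).eval (powLog κ t))
    (fun i j => (hint j).mono_set (hsub i))
  rw [← Measure.restrict_pi_pi, ← volume_pi] at key
  have hval : ∀ i j : Fin n, ∫ t in Set.Ioo (z i.castSucc) (z i.succ),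
      w t * (twoTerm r j).eval (powLog κ t) = h j (z i.succ) - h j (z i.castSucc) := by
    intro i j
    rw [← integral_Ioc_eq_integral_Ioo, ← intervalIntegral.integral_of_le (hle i)]
    refine intervalIntegral.integral_eq_sub_of_hasDerivAt_of_le (hle i)
      ((hcont j).mono (Set.Icc_subset_Icc (hza _) (hzb _)))
      (fun t ht => hderiv j t (hsub i ht)) ?_
    rw [intervalIntegrable_iff_integrableOn_Ioo_of_le (hle i)]
    exact (hint j).mono_set (hsub i)
  simp only [hval, ← hdet] at key
  have hm : MeasurableSet (gapBox z) := MeasurableSet.univ_pi fun _ => measurableSet_Ioo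
  -- The determinant is the integral of a nonnegative function, hence equal to its absolute value.
  have hnn : 0 ≤ᵐ[volume.restrict (gapBox z)] fun y : Fin n → ℝ => vdm κ y * ∏ i, w (y i) := by
    filter_upwards [ae_restrict_mem hm] with y hy
    exact mul_nonneg (vdm_pos hκ (strictMono_of_mem_gapBox hz hy) fun i =>
        ha.trans_lt (hsub i (hy i trivial)).1).le
      (Finset.prod_nonneg fun i _ => hw _ (hsub i (hy i trivial)))
  have h5 := integral_nonneg_of_ae hnn
  obtain ⟨key1, key2⟩ := key
  change Integrable _ (volume.restrict (gapBox z)) at key1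
  rw [← ofReal_integral_eq_lintegral_ofReal key1 hnn]
  rw [← abs_of_nonneg h5]
  exact congrArg (fun t => ENNReal.ofReal |t|) key2

/-! ### One-step integrals over interlacing configurations -/

lemma eval_twoTerm_zero (j : ℕ) (t : ℝ) : (twoTerm 0 j).eval t = t ^ j := by
  rcases j with _ | j <;> simp [twoTerm]

lemma eval_twoTerm_succ (r : ℕ → ℝ) (j : ℕ) (t : ℝ) :
    (twoTerm r (j + 1)).eval t = t ^ (j + 1) + r (j + 1) * t ^ j := by
  simp [twoTerm]

lemma weight_nonneg {κ : ℝ} (hκ : 0 ≤ κ) (c : ℝ) (m : ℕ) {t : ℝ} (h0 : 0 < t) (h1 : t < 1) :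
    0 ≤ t ^ c * powDiff κ 1 t ^ m :=
  mul_nonneg (Real.rpow_nonneg h0.le _) (pow_nonneg (powDiff_pos hκ h0 h1).le _)

/-- For the weight `t ^ (κ - 1) ψ ^ m`, a multiple of `φ' ψ ^ m`, where `ψ = -φ`, the
antiderivatives are the powers of `φ`. -/
lemma lintegral_gapBox_deriv_weight {κ : ℝ} (hκ : 0 ≤ κ) (m : ℕ) {n : ℕ} {z : Fin (n + 1) → ℝ}
    (hz : Monotone z) (h0 : 0 < z 0) (h1 : z (Fin.last n) ≤ 1) :
    ∫⁻ y in gapBox z,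
        ENNReal.ofReal (vdm κ y * ∏ i, (y i ^ (κ - 1) * powDiff κ 1 (y i) ^ m)) =
      ENNReal.ofReal |(Matrix.of fun i j : Fin n =>
        (-1) ^ m / (powLogSlope κ * (m + j + 1)) * powLog κ (z i.succ) ^ (m + j + 1)
        - (-1) ^ m / (powLogSlope κ * (m + j + 1))
          * powLog κ (z i.castSucc) ^ (m + j + 1)).det| := by
  have hB := powLogSlope_pos hκ
  have hpos : ∀ t ∈ Set.Icc (z 0) (z (Fin.last n)), 0 < t := fun t ht => h0.trans_le ht.1
  have hφ : ContinuousOn (powLog κ) (Set.Icc (z 0) (z (Fin.last n))) :=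
    (continuousOn_powLog κ).mono hpos
  refine lintegral_gapBox (w := fun t => t ^ (κ - 1) * powDiff κ 1 t ^ m) hκ h0.le hz
    (fun i => hz (Fin.zero_le i)) (fun i => hz (Fin.le_last i))
    (fun t ht => weight_nonneg hκ _ m (h0.trans ht.1) (ht.2.trans_le h1)) 0
    (fun j t => (-1) ^ m / (powLogSlope κ * (m + j + 1)) * powLog κ t ^ (m + j + 1))
    (fun j => continuousOn_const.mul (hφ.pow _)) (fun j t ht => ?_) (fun j => ?_)
  · have h2 := ((hasDerivAt_powLog κ (h0.trans ht.1)).pow (m + j + 1)).const_mul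
      ((-1) ^ m / (powLogSlope κ * (m + j + 1)))
    refine h2.congr_deriv ?_
    have h3 : ((m : ℝ) + j + 1) ≠ 0 := by positivity
    rw [eval_twoTerm_zero, powDiff_one_left]
    push_cast
    field_simp
    rw [pow_add, neg_pow (powLog κ t) m]
    ring
  · refine ContinuousOn.integrableOn_Icc (ContinuousOn.mul (ContinuousOn.mul ?_ ?_) ?_) |>.mono_set
      Set.Ioo_subset_Icc_self
    · exact fun t ht => (Real.continuousAt_rpow_const t _
        (Or.inl (hpos t ht).ne')).continuousWithinAt
    · simp only [powDiff_one_left]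
      exact hφ.neg.pow m
    · simp only [eval_twoTerm_zero]
      exact hφ.pow j

/-- Integration over the `y` with `x_1 < y_1 < x_2 < ⋯ < y_{n-1} < x_n` reproduces the
Vandermonde product. -/
lemma exists_lintegral_interlace_lt {κ : ℝ} (hκ : 0 ≤ κ) {m n : ℕ} (hn : n = m + 1) :
    ∃ C : ℝ, 0 < C ∧ ∀ x ∈ orderedPoints n,
      ∫⁻ y in {y : Fin m → ℝ | y ∈ orderedPoints m ∧ Interlace y x},
        ENNReal.ofReal (vdm κ y * ∏ i, y i ^ (κ - 1)) = ENNReal.ofReal (C * vdm κ x) := by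
  subst hn
  have hB := powLogSlope_pos hκ
  have hd : ∀ j : Fin m, 0 < 1 / (powLogSlope κ * ((j : ℝ) + 1)) := fun j => by positivity
  refine ⟨∏ j : Fin m, 1 / (powLogSlope κ * ((j : ℝ) + 1)), Finset.prod_pos fun j _ => hd j, ?_⟩
  intro x hx
  have hset : {y : Fin m → ℝ | y ∈ orderedPoints m ∧ Interlace y x} = gapBox x := by
    ext y
    constructor
    · rintro ⟨-, -, h2, h3⟩ i -
      exact ⟨h2 _ _ rfl, h3 _ _ rfl⟩
    · intro hy
      refine ⟨⟨strictMono_of_mem_gapBox hx.1.monotone hy, fun i => ?_⟩, Or.inr rfl,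
        fun i j h => ?_, fun i j h => ?_⟩
      · exact ⟨(hx.2 _).1.trans (hy i trivial).1, (hy i trivial).2.trans (hx.2 _).2⟩
      · obtain rfl : i = j.castSucc := Fin.ext h
        exact (hy j trivial).1
      · obtain rfl : i = j.succ := Fin.ext h
        exact (hy j trivial).2
  have h1 := lintegral_gapBox_deriv_weight hκ 0 hx.1.monotone (hx.2 _).1 (hx.2 _).2.le
  simp only [pow_zero, mul_one] at h1
  rw [hset, h1, det_sub_eq_det_cons_one fun (j : Fin m) t =>
    1 / (powLogSlope κ * (((0 : ℕ) : ℝ) + j + 1)) * powLog κ t ^ (0 + (j : ℕ) + 1)]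
  have h2 : (Matrix.of fun i : Fin (m + 1) => (Fin.cons 1 (fun j : Fin m =>
      1 / (powLogSlope κ * (((0 : ℕ) : ℝ) + j + 1)) * powLog κ (x i) ^ (0 + (j : ℕ) + 1)) :
        Fin (m + 1) → ℝ)) = Matrix.of fun i j =>
      (Fin.cons 1 (fun j : Fin m => 1 / (powLogSlope κ * ((j : ℝ) + 1))) : Fin (m + 1) → ℝ) j *
        Matrix.vandermonde (fun i => powLog κ (x i)) i j := by
    ext i j
    refine Fin.cases ?_ (fun j => ?_) j
    · simp
    · simp [Matrix.vandermonde_apply]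
  rw [h2, Matrix.det_mul_row, ← vdm_eq_det, Fin.prod_univ_succ]
  simp only [Fin.cons_zero, Fin.cons_succ, one_mul]
  rw [abs_of_pos (mul_pos (Finset.prod_pos fun j _ => hd j)
    (vdm_pos hκ hx.1 fun i => (hx.2 i).1))]

lemma monotone_snoc {n : ℕ} {x : Fin n → ℝ} {b : ℝ} (hx : Monotone x) (hb : ∀ i, x i ≤ b) :
    Monotone (Fin.snoc x b : Fin (n + 1) → ℝ) := by
  intro i j hij
  induction j using Fin.lastCases with
  | last =>
    induction i using Fin.lastCases with
    | last => exact le_rfl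
    | cast i => simpa using hb i
  | cast j =>
    induction i using Fin.lastCases with
    | last => exact absurd hij (not_le.2 (Fin.castSucc_lt_last j))
    | cast i => simpa using hx (by simpa using hij)

lemma monotone_cons {n : ℕ} {x : Fin n → ℝ} {a : ℝ} (hx : Monotone x) (ha : ∀ i, a ≤ x i) :
    Monotone (Fin.cons a x : Fin (n + 1) → ℝ) := by
  intro i j hij
  induction i using Fin.cases with
  | zero =>
    induction j using Fin.cases with
    | zero => exact le_rfl
    | succ j => simpa using ha j
  | succ i =>
    induction j using Fin.cases with
    | zero => exact absurd hij (not_le.2 (Fin.succ_pos i))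
    | succ j => simpa using hx (by simpa using hij)

lemma abs_prod_eq {n : ℕ} {f g : Fin n → ℝ} (h : ∀ i, |f i| = g i) : |∏ i, f i| = ∏ i, g i := by
  rw [Finset.abs_prod]
  exact Finset.prod_congr rfl fun i _ => h i

/-- Integration over the `y` with `x_1 < y_1 < x_2 < ⋯ < x_n < y_n < 1`, where all the
antiderivatives vanish at `1`. -/
lemma exists_lintegral_interlace_eq {κ : ℝ} (hκ : 0 ≤ κ) (m : ℕ) {l n : ℕ} (hn : n = l) :
    ∃ C : ℝ, 0 < C ∧ ∀ x ∈ orderedPoints n,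
      ∫⁻ y in {y : Fin l → ℝ | y ∈ orderedPoints l ∧ Interlace y x},
        ENNReal.ofReal (vdm κ y * ∏ i, (y i ^ (κ - 1) * powDiff κ 1 (y i) ^ m)) =
          ENNReal.ofReal (C * (vdm κ x * ∏ i, powDiff κ 1 (x i) ^ (m + 1))) := by
  subst hn
  have hB := powLogSlope_pos hκ
  let d : Fin n → ℝ := fun j => (-1) ^ m / (powLogSlope κ * (m + j + 1))
  have hd : ∀ j, 0 < |d j| := fun j => abs_pos.2 (by dsimp only [d]; positivity)
  refine ⟨∏ j, |d j|, Finset.prod_pos fun j _ => hd j, ?_⟩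
  intro x hx
  let z : Fin (n + 1) → ℝ := Fin.snoc x 1
  have hzc : ∀ i : Fin n, z i.castSucc = x i := fun i => by simp [z]
  have hzl : z (Fin.last n) = 1 := by simp [z]
  have hz : Monotone z := monotone_snoc hx.1.monotone fun i => (hx.2 i).2.le
  have hz0 : ∀ i, 0 < z i := fun i => by
    induction i using Fin.lastCases with
    | last => rw [hzl]; exact one_pos
    | cast i => rw [hzc]; exact (hx.2 i).1
  have hset : {y : Fin n → ℝ | y ∈ orderedPoints n ∧ Interlace y x} = gapBox z := by
    ext y
    constructor
    · rintro ⟨hy, -, h2, h3⟩ i -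
      refine ⟨by rw [hzc]; exact h2 _ _ rfl, ?_⟩
      rcases Nat.lt_or_ge (i + 1) n with hi | hi
      · have : i.succ = (⟨i + 1, hi⟩ : Fin n).castSucc := rfl
        rw [this, hzc]
        exact h3 _ _ rfl
      · have : i.succ = Fin.last n := Fin.ext (by simp; omega)
        rw [this, hzl]
        exact (hy.2 i).2
    · intro hy
      refine ⟨⟨strictMono_of_mem_gapBox hz hy, fun i => ?_⟩, Or.inl rfl,
        fun i j h => ?_, fun i j h => ?_⟩
      · exact ⟨(hz0 _).trans (hy i trivial).1,
          (hy i trivial).2.trans_le ((hz (Fin.le_last _)).trans hzl.le)⟩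
      · obtain rfl : i = j := Fin.ext h
        have := (hy i trivial).1
        rwa [hzc] at this
      · have := (hy j trivial).2
        have h' : j.succ = i.castSucc := Fin.ext h.symm
        rwa [h', hzc] at this
  rw [hset, lintegral_gapBox_deriv_weight hκ m hz (hz0 0) hzl.le]
  rw [det_sub_eq_det_cons_one fun (j : Fin n) t => d j * powLog κ t ^ (m + (j : ℕ) + 1),
    abs_det_of_last_row _ fun j => by simp [hzl, powLog_one]]
  have h2 : (Matrix.of fun i : Fin (n + 1) => (Fin.cons 1 (fun j : Fin n =>
      d j * powLog κ (z i) ^ (m + (j : ℕ) + 1)) : Fin (n + 1) → ℝ)).submatrix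
        Fin.castSucc Fin.succ = Matrix.of fun i j => d j * (Matrix.of fun i j =>
          powLog κ (x i) ^ (m + 1) * Matrix.vandermonde (fun i => powLog κ (x i)) i j) i j := by
    ext i j
    simp only [Matrix.submatrix_apply, Matrix.of_apply, Fin.cons_succ, hzc,
      Matrix.vandermonde_apply]
    ring
  rw [h2, Matrix.det_mul_row, Matrix.det_mul_column, ← vdm_eq_det, abs_mul, abs_mul,
    abs_of_pos (vdm_pos hκ hx.1 fun i => (hx.2 i).1), Finset.abs_prod,
    abs_prod_eq (g := fun i => powDiff κ 1 (x i) ^ (m + 1)) fun i => ?_]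
  · simp only [Matrix.of_apply, Fin.cons_zero, abs_one, one_mul]
    rw [mul_comm (vdm κ x)]
  · rw [abs_pow, ← abs_of_pos (powDiff_pos hκ (hx.2 i).1 (hx.2 i).2), powDiff_one_left, abs_neg]

/-- The antiderivatives for the weight `t ^ (c - 1) ψ ^ m`, where `ψ = -φ`; the one of degree `0`
is left unspecified. -/
noncomputable def powPrimitive (c κ : ℝ) (m : ℕ) (h0 : ℝ → ℝ) (j : ℕ) (t : ℝ) : ℝ :=
  if j = 0 then h0 t
  else (-1) ^ m / (c + (m + j : ℕ) * κ) * (t ^ c * powLog κ t ^ (m + j))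

/-- For the weight `t ^ (c - 1) ψ ^ m` the derivative of `t ^ c φ ^ (m + j)` is a multiple of the
weight times `φ ^ j + r_j φ ^ (j - 1)`; only the antiderivative `h0` of the weight itself need not
be elementary. -/
lemma lintegral_gapBox_rpow_weight {c κ : ℝ} (hc : 0 < c) (hκ : 0 ≤ κ) (m : ℕ) {n : ℕ}
    {z : Fin (n + 1) → ℝ} (hz : Monotone z) (hz0 : ∀ i, 0 ≤ z i) (hz1 : ∀ i, z i ≤ 1)
    {h0 : ℝ → ℝ} (hcont : ContinuousOn h0 (Set.Icc 0 1))
    (hderiv : ∀ t ∈ Set.Ioo (0 : ℝ) 1, HasDerivAt h0 (t ^ (c - 1) * powDiff κ 1 t ^ m) t) :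
    ∫⁻ y in gapBox z,
        ENNReal.ofReal (vdm κ y * ∏ i, (y i ^ (c - 1) * powDiff κ 1 (y i) ^ m)) =
      ENNReal.ofReal |(Matrix.of fun i j : Fin n => powPrimitive c κ m h0 j (z i.succ)
        - powPrimitive c κ m h0 j (z i.castSucc)).det| := by
  refine lintegral_gapBox (a := 0) (b := 1) (w := fun t => t ^ (c - 1) * powDiff κ 1 t ^ m)
    hκ le_rfl hz hz0 hz1 (fun t ht => weight_nonneg hκ _ m ht.1 ht.2)
    (fun j => (m + j : ℕ) * powLogSlope κ / (c + (m + j : ℕ) * κ))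
    (fun j => powPrimitive c κ m h0 j) (fun j => ?_) (fun j t ht => ?_) (fun j => ?_)
  · rcases hj : (j : ℕ) with _ | k
    · exact hcont.congr fun t _ => by simp [powPrimitive]
    · refine ContinuousOn.congr (f := fun t => (-1) ^ m / (c + (m + (k + 1) : ℕ) * κ) *
        (t ^ c * powLog κ t ^ (m + (k + 1)))) (continuousOn_const.mul
        ((continuousOn_rpow_mul_powLog_pow hc hκ _).mono fun t ht => ht.1)) fun t _ => ?_
      simp [powPrimitive]
  · rcases hj : (j : ℕ) with _ | k
    · have : powPrimitive c κ m h0 0 = h0 := by funext t; simp [powPrimitive]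
      simpa [twoTerm, this] using hderiv t ht
    · have : powPrimitive c κ m h0 (k + 1) = fun t => (-1) ^ m / (c + (m + (k + 1) : ℕ) * κ) *
        (t ^ c * powLog κ t ^ (m + (k + 1))) := by funext t; simp [powPrimitive]
      rw [this]
      have h2 := (hasDerivAt_rpow_mul_powLog_pow c κ (m + (k + 1)) ht.1).const_mul
        ((-1) ^ m / (c + (m + (k + 1) : ℕ) * κ))
      refine h2.congr_deriv ?_
      have h3 : c + (m + (k + 1) : ℕ) * κ ≠ 0 := by positivity
      rw [eval_twoTerm_succ, powDiff_one_left, neg_pow]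
      simp only [← add_assoc, Nat.add_sub_cancel] at h3 ⊢
      rw [pow_add, pow_add]
      field_simp
      ring
  · have h3 : ∀ k : ℕ, IntegrableOn (fun t => (-1) ^ m * (t ^ (c - 1) * powLog κ t ^ (m + k)))
        (Set.Ioo 0 1) := fun k => (integrableOn_rpow_mul_powLog_pow hc hκ (m + k)).const_mul _
    rcases hj : (j : ℕ) with _ | k
    · refine (h3 0).congr_fun (fun t _ => ?_) measurableSet_Ioo
      simp only [twoTerm, powDiff_one_left, Polynomial.eval_one, add_zero]
      rw [neg_pow]; ring
    · refine IntegrableOn.congr_fun ((h3 (k + 1)).add ((h3 k).const_mul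
        ((m + (k + 1) : ℕ) * powLogSlope κ / (c + (m + (k + 1) : ℕ) * κ))))
        (fun t _ => ?_) measurableSet_Ioo
      simp only [eval_twoTerm_succ, powDiff_one_left, Pi.add_apply]
      rw [neg_pow, pow_add, pow_add]; ring

lemma powPrimitive_zero_right {c κ : ℝ} (hc : 0 < c) (m : ℕ) {h0 : ℝ → ℝ} (h : h0 0 = 0)
    (j : ℕ) : powPrimitive c κ m h0 j 0 = 0 := by
  unfold powPrimitive
  split_ifs
  · exact h
  · simp [Real.zero_rpow hc.ne']

/-- Integration over the `y` with `0 < y_1 < x_1 < y_2 < ⋯ < y_n < x_n`, where all the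
antiderivatives vanish at `0`. -/
lemma exists_lintegral_eq_interlace {c κ : ℝ} (hc : 0 < c) (hκ : 0 ≤ κ) {l n : ℕ} (hn : l = n) :
    ∃ C : ℝ, 0 < C ∧ ∀ x ∈ orderedPoints n,
      ∫⁻ y in {y : Fin l → ℝ | y ∈ orderedPoints l ∧ Interlace x y},
        ENNReal.ofReal (vdm κ y * ∏ i, y i ^ (c - 1)) =
          ENNReal.ofReal (C * (vdm κ x * ∏ i, x i ^ c)) := by
  subst hn
  let d : Fin l → ℝ := fun j => 1 / (c + (j : ℕ) * κ)
  have hd : ∀ j, 0 < d j := fun j => by dsimp only [d]; positivity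
  refine ⟨∏ j, d j, Finset.prod_pos fun j _ => hd j, ?_⟩
  intro x hx
  let z : Fin (l + 1) → ℝ := Fin.cons 0 x
  have hzs : ∀ i : Fin l, z i.succ = x i := fun i => by simp [z]
  have hz0 : z 0 = 0 := by simp [z]
  have hz : Monotone z := monotone_cons hx.1.monotone fun i => (hx.2 i).1.le
  have hznn : ∀ i, 0 ≤ z i := fun i => hz0.symm.le.trans (hz (Fin.zero_le i))
  have hz1 : ∀ i, z i < 1 := fun i => by
    induction i using Fin.cases with
    | zero => rw [hz0]; exact one_pos
    | succ i => rw [hzs]; exact (hx.2 i).2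
  have hset : {y : Fin l → ℝ | y ∈ orderedPoints l ∧ Interlace x y} = gapBox z := by
    ext y
    constructor
    · rintro ⟨hy, -, h2, h3⟩ i -
      refine ⟨?_, by rw [hzs]; exact h2 _ _ rfl⟩
      rcases hi : (i : ℕ) with _ | k
      · have : i.castSucc = 0 := Fin.ext hi
        rw [this, hz0]
        exact (hy.2 i).1
      · have : i.castSucc = (⟨k, by omega⟩ : Fin l).succ := Fin.ext (by simp [hi])
        rw [this, hzs]
        exact h3 _ _ (by simp [hi])
    · intro hy
      refine ⟨⟨strictMono_of_mem_gapBox hz hy, fun i => ?_⟩, Or.inl rfl,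
        fun i j h => ?_, fun i j h => ?_⟩
      · exact ⟨(hznn _).trans_lt (hy i trivial).1, (hy i trivial).2.trans (hz1 _)⟩
      · obtain rfl : i = j := Fin.ext h
        have := (hy i trivial).2
        rwa [hzs] at this
      · have := (hy i trivial).1
        have h' : i.castSucc = j.succ := Fin.ext h
        rwa [h', hzs] at this
  have h1 := lintegral_gapBox_rpow_weight (h0 := fun t => 1 / c * (t ^ c * powLog κ t ^ 0)) hc hκ
    0 hz hznn (fun i => (hz1 i).le)
    (continuousOn_const.mul ((continuousOn_rpow_mul_powLog_pow hc hκ 0).mono fun t ht => ht.1))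
    (fun t ht => ((hasDerivAt_rpow_mul_powLog_pow c κ 0 ht.1).const_mul (1 / c)).congr_deriv
      (by field_simp; simp [mul_comm]))
  simp only [pow_zero, mul_one] at h1
  rw [hset, h1, det_sub_eq_det_cons_one fun (j : Fin l) t => powPrimitive c κ 0
    (fun t => 1 / c * t ^ c) j t, det_of_first_row _ fun j => by
      simp only [Matrix.of_apply, Fin.cons_succ, hz0]
      exact powPrimitive_zero_right hc 0 (by simp [Real.zero_rpow hc.ne']) j]
  have h2 : (Matrix.of fun i : Fin (l + 1) => (Fin.cons 1 (fun j : Fin l =>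
      powPrimitive c κ 0 (fun t => 1 / c * t ^ c) j (z i)) : Fin (l + 1) → ℝ)).submatrix
        Fin.succ Fin.succ = Matrix.of fun i j => d j * (Matrix.of fun i j =>
          x i ^ c * Matrix.vandermonde (fun i => powLog κ (x i)) i j) i j := by
    ext i j
    simp only [Matrix.submatrix_apply, Matrix.of_apply, Fin.cons_succ, hzs,
      Matrix.vandermonde_apply, powPrimitive, d]
    split_ifs with h
    · simp [h]
    · simp
  rw [h2, Matrix.det_mul_row, Matrix.det_mul_column, ← vdm_eq_det]
  simp only [Matrix.of_apply, Fin.cons_zero, one_mul]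
  rw [mul_comm (vdm κ x), abs_of_pos]
  exact mul_pos (Finset.prod_pos fun j _ => hd j) (mul_pos (Finset.prod_pos fun i _ =>
    Real.rpow_pos_of_pos (hx.2 i).1 _) (vdm_pos hκ hx.1 fun i => (hx.2 i).1))

/-- Integration over the `y` with `0 < y_1 < x_1 < y_2 < ⋯ < x_n < y_{n+1} < 1`. All the
antiderivatives vanish at `0`, and all but the first one vanish at `1`; so the bordered determinant
reduces to the one with entries at `x_1, …, x_n`. -/
lemma exists_lintegral_lt_interlace {c κ : ℝ} (hc : 0 < c) (hκ : 0 ≤ κ) (m : ℕ) {l n : ℕ}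
    (hn : l = n + 1) :
    ∃ C : ℝ, 0 < C ∧ ∀ x ∈ orderedPoints n,
      ∫⁻ y in {y : Fin l → ℝ | y ∈ orderedPoints l ∧ Interlace x y},
        ENNReal.ofReal (vdm κ y * ∏ i, (y i ^ (c - 1) * powDiff κ 1 (y i) ^ m)) =
          ENNReal.ofReal (C * (vdm κ x * ∏ i, (x i ^ c * powDiff κ 1 (x i) ^ (m + 1)))) := by
  subst hn
  -- For `m > 0` the antiderivative of the weight is an incomplete beta integral; only its
  -- positivity at `1` matters.
  let w : ℝ → ℝ := fun t => t ^ (c - 1) * powDiff κ 1 t ^ m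
  have hwi : IntegrableOn w (Set.Ioo 0 1) := by
    refine IntegrableOn.congr_fun
      ((integrableOn_rpow_mul_powLog_pow hc hκ m).const_mul ((-1) ^ m)) (fun t _ => ?_)
      measurableSet_Ioo
    simp only [w, powDiff_one_left]
    rw [neg_pow]; ring
  have hwi' : IntervalIntegrable w volume 0 1 := by
    rwa [intervalIntegrable_iff_integrableOn_Ioo_of_le zero_le_one]
  let h0 : ℝ → ℝ := fun t => ∫ s in (0 : ℝ)..t, w s
  have h00 : h0 0 = 0 := intervalIntegral.integral_same
  have h01 : 0 < h0 1 := by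
    refine intervalIntegral.intervalIntegral_pos_of_pos_on hwi' (fun t ht => ?_) one_pos
    exact mul_pos (Real.rpow_pos_of_pos ht.1 _) (pow_pos (powDiff_pos hκ ht.1 ht.2) _)
  have hwc : ContinuousOn w (Set.Ioi 0) := fun t ht =>
    ((Real.continuousAt_rpow_const t _ (Or.inl (ne_of_gt ht))).mul (by
      simp only [powDiff_one_left]
      exact ((hasDerivAt_powLog κ ht).continuousAt.neg.pow m))).continuousWithinAt
  have hcont : ContinuousOn h0 (Set.Icc 0 1) :=
    intervalIntegral.continuousOn_primitive_interval'
      (b₂ := 1) hwi' Set.left_mem_uIcc |>.mono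
      (by rw [Set.uIcc_of_le zero_le_one])
  have hderiv : ∀ t ∈ Set.Ioo (0 : ℝ) 1, HasDerivAt h0 (w t) t := fun t ht => by
    refine intervalIntegral.integral_hasDerivAt_right
      (hwi'.mono_set (Set.uIcc_subset_uIcc_left (by
        rw [Set.uIcc_of_le zero_le_one]; exact ⟨ht.1.le, ht.2.le⟩)))
      (hwc.stronglyMeasurableAtFilter isOpen_Ioi t ht.1)
      (hwc.continuousAt (Ioi_mem_nhds ht.1))
  let d : Fin n → ℝ := fun j => (-1) ^ m / (c + (m + (j + 1) : ℕ) * κ)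
  have hd : ∀ j, 0 < |d j| := fun j => abs_pos.2 (by dsimp only [d]; positivity)
  refine ⟨h0 1 * ∏ j, |d j|, mul_pos h01 (Finset.prod_pos fun j _ => hd j), ?_⟩
  intro x hx
  let z : Fin (n + 1 + 1) → ℝ := Fin.cons 0 (Fin.snoc x 1 : Fin (n + 1) → ℝ)
  have hzs : ∀ i : Fin n, z i.castSucc.succ = x i := fun i => by simp [z]
  have hz0 : z 0 = 0 := by simp [z]
  have hzl : z (Fin.last n).succ = 1 := by simp [z]
  have hz : Monotone z := monotone_cons (monotone_snoc hx.1.monotone fun i => (hx.2 i).2.le)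
    fun i => by
      induction i using Fin.lastCases with
      | last => simp
      | cast i => simpa using (hx.2 i).1.le
  have hznn : ∀ i, 0 ≤ z i := fun i => hz0.symm.le.trans (hz (Fin.zero_le i))
  have hz1 : ∀ i, z i ≤ 1 := fun i => (hz (Fin.le_last i)).trans hzl.le
  have hset : {y : Fin (n + 1) → ℝ | y ∈ orderedPoints (n + 1) ∧ Interlace x y} = gapBox z := by
    ext y
    constructor
    · rintro ⟨hy, -, h2, h3⟩ i -
      constructor
      · induction i using Fin.cases with
        | zero => simpa [hz0] using (hy.2 0).1
        | succ i =>
          rw [← Fin.succ_castSucc, hzs]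
          exact h3 _ _ rfl
      · induction i using Fin.lastCases with
        | last => rw [hzl]; exact (hy.2 _).2
        | cast i => rw [hzs]; exact h2 _ _ rfl
    · intro hy
      refine ⟨⟨strictMono_of_mem_gapBox hz hy, fun i => ?_⟩, Or.inr rfl,
        fun i j h => ?_, fun i j h => ?_⟩
      · exact ⟨(hznn _).trans_lt (hy i trivial).1, (hy i trivial).2.trans_le (hz1 _)⟩
      · obtain rfl : i = j.castSucc := Fin.ext h
        have := (hy j.castSucc trivial).2
        rwa [hzs] at this
      · obtain rfl : i = j.succ := Fin.ext h
        have := (hy j.succ trivial).1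
        rwa [← Fin.succ_castSucc, hzs] at this
  rw [hset, lintegral_gapBox_rpow_weight hc hκ m hz hznn hz1 hcont hderiv,
    det_sub_eq_det_cons_one fun (j : Fin (n + 1)) t => powPrimitive c κ m h0 j t,
    det_of_first_row _ fun j => by
      simp only [Matrix.of_apply, Fin.cons_succ, hz0]
      exact powPrimitive_zero_right hc m h00 j,
    abs_mul, abs_det_of_last_row _ fun j => by
      have h3 : z (Fin.last (n + 1)) = 1 := hzl
      simp [h3, powPrimitive, powLog_one]]
  have h2 : ((Matrix.of fun i : Fin (n + 1 + 1) => (Fin.cons 1 (fun j : Fin (n + 1) =>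
      powPrimitive c κ m h0 j (z i)) : Fin (n + 1 + 1) → ℝ)).submatrix
        Fin.succ Fin.succ).submatrix Fin.castSucc Fin.succ =
      Matrix.of fun i j => d j * (Matrix.of fun i j => (x i ^ c * powLog κ (x i) ^ (m + 1)) *
        Matrix.vandermonde (fun i => powLog κ (x i)) i j) i j := by
    ext i j
    simp only [Matrix.submatrix_apply, Matrix.of_apply, Fin.cons_succ, hzs,
      Matrix.vandermonde_apply, powPrimitive, d]
    rw [if_neg (by simp)]
    simp only [Fin.val_succ]
    ring
  rw [h2, Matrix.det_mul_row, Matrix.det_mul_column, ← vdm_eq_det, abs_mul, abs_mul,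
    abs_of_pos (vdm_pos hκ hx.1 fun i => (hx.2 i).1), Finset.abs_prod,
    abs_prod_eq (g := fun i => x i ^ c * powDiff κ 1 (x i) ^ (m + 1)) fun i => ?_]
  · have h3 : powPrimitive c κ m h0 0 1 = h0 1 := by simp [powPrimitive]
    simp only [Matrix.submatrix_apply, Matrix.of_apply, Fin.cons_zero, Fin.cons_succ, abs_one,
      one_mul, hzl, Fin.val_zero, h3, abs_of_pos h01]
    rw [mul_comm (vdm κ x), mul_assoc]
  · rw [abs_mul, abs_pow, ← abs_of_pos (powDiff_pos hκ (hx.2 i).1 (hx.2 i).2), powDiff_one_left,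
      abs_neg, abs_of_pos (Real.rpow_pos_of_pos (hx.2 i).1 _)]

/-! ### The limiting chain of interlacing slices -/

noncomputable instance instFintypeTime (M N : ℕ) : Fintype (Time M N) :=
  (Set.finite_Icc (-(M : ℤ) + 1) ((N : ℤ) - 1)).fintype

lemma time_induction_up {M N : ℕ} {P : Time M N → Prop}
    (h0 : ∀ t : Time M N, (t : ℤ) = -(M : ℤ) + 1 → P t)
    (h1 : ∀ s t : Time M N, (t : ℤ) = s + 1 → P s → P t) (t : Time M N) : P t := by
  obtain ⟨n, hn⟩ : ∃ n : ℕ, (t : ℤ) = -(M : ℤ) + 1 + n :=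
    ⟨((t : ℤ) - (-(M : ℤ) + 1)).toNat, by have := t.2.1; omega⟩
  induction n generalizing t with
  | zero => exact h0 t (by simpa using hn)
  | succ n ih =>
    have := t.2.2
    exact h1 ⟨(t : ℤ) - 1, by omega, by omega⟩ t (by simp) (ih _ (by simp only; omega))

lemma time_induction_down {M N : ℕ} {P : Time M N → Prop}
    (h0 : ∀ t : Time M N, (t : ℤ) = (N : ℤ) - 1 → P t)
    (h1 : ∀ s t : Time M N, (t : ℤ) = s + 1 → P t → P s) (t : Time M N) : P t := by
  obtain ⟨n, hn⟩ : ∃ n : ℕ, (t : ℤ) = (N : ℤ) - 1 - n :=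
    ⟨((N : ℤ) - 1 - t).toNat, by have := t.2.2; omega⟩
  induction n generalizing t with
  | zero => exact h0 t (by simpa using hn)
  | succ n ih =>
    have := t.2.1
    exact h1 t ⟨(t : ℤ) + 1, by omega, by omega⟩ (by simp) (ih _ (by simp only; omega))

/-- The weight exponent at the centre. -/
noncomputable def centralRate (α η θ : ℝ) : ℝ := α + (η + θ) / 2

/-- A part of size `l` in the slice at time `t` has weight `q ^ (rate t * l)`. -/
noncomputable def rate (α η θ : ℝ) (t : ℤ) : ℝ :=
  if t < 0 then η else if t = 0 then centralRate α η θ else θ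

lemma centralRate_pos {α η θ : ℝ} (hα : 0 ≤ α) (hη : 0 ≤ η) (hθ : 0 ≤ θ)
    (hne : ¬ (α = 0 ∧ η = 0 ∧ θ = 0)) : 0 < centralRate α η θ := by
  unfold centralRate
  by_contra h
  exact hne ⟨by linarith, by linarith, by linarith⟩

/-- The interlacing relation between consecutive slices `y` at time `t - 1` and `x` at time `t`. -/
def LinkRel {m n : ℕ} (t : ℤ) (y : Fin m → ℝ) (x : Fin n → ℝ) : Prop :=
  if t ≤ 0 then Interlace y x else Interlace x y

/-- The weight per point left after integrating out all slices before time `t`. -/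
noncomputable def leftWeight (M N : ℕ) (α η θ : ℝ) (t : ℤ) (u : ℝ) : ℝ :=
  if t ≤ 0 then 1
  else u ^ (centralRate α η θ + ((t : ℝ) - 1) * θ) * powDiff η 1 u ^ (M - (N - t.natAbs))

/-- The weight per point left after integrating out all slices after time `t`. -/
noncomputable def rightWeight (M N : ℕ) (α η θ : ℝ) (t : ℤ) (u : ℝ) : ℝ :=
  if 0 ≤ t then powDiff θ 1 u ^ (N - t.natAbs - M)
  else u ^ (centralRate α η θ + ((t.natAbs : ℝ) - 1) * η) * powDiff θ 1 u ^ (N - (M - t.natAbs))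

lemma setLIntegral_congr_ordered {l : ℕ} {p : (Fin l → ℝ) → Prop} {f g : (Fin l → ℝ) → ℝ≥0∞}
    (hm : MeasurableSet {y | y ∈ orderedPoints l ∧ p y})
    (h : ∀ y ∈ orderedPoints l, f y = g y) :
    ∫⁻ y in {y | y ∈ orderedPoints l ∧ p y}, f y = ∫⁻ y in {y | y ∈ orderedPoints l ∧ p y}, g y :=
  setLIntegral_congr_fun hm fun y hy => h y hy.1

lemma measurable_interlace {X : Type*} [MeasurableSpace X] {m n : ℕ} {f : X → Fin m → ℝ}
    {g : X → Fin n → ℝ} (hf : Measurable f) (hg : Measurable g) :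
    Measurable fun x => Interlace (f x) (g x) := by
  unfold Interlace
  refine measurable_const.and (Measurable.and ?_ ?_) <;>
  · refine Measurable.forall fun i => Measurable.forall fun j => measurable_const.imp ?_
    exact measurableSet_setOfPred.1 (measurableSet_lt (by fun_prop) (by fun_prop))

lemma measurable_linkRel {X : Type*} [MeasurableSpace X] {m n : ℕ} (t : ℤ) {f : X → Fin m → ℝ}
    {g : X → Fin n → ℝ} (hf : Measurable f) (hg : Measurable g) :
    Measurable fun x => LinkRel t (f x) (g x) := by
  unfold LinkRel
  split_ifs
  · exact measurable_interlace hf hg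
  · exact measurable_interlace hg hf

lemma measurableSet_orderedPoints (n : ℕ) : MeasurableSet (orderedPoints n) := by
  refine measurableSet_setOfPred.2 (Measurable.and ?_ ?_)
  · unfold StrictMono
    refine Measurable.forall fun i => Measurable.forall fun j => measurable_const.imp ?_
    exact measurableSet_setOfPred.1 (measurableSet_lt (by fun_prop) (by fun_prop))
  · exact Measurable.forall fun i =>
      measurableSet_setOfPred.1 (measurableSet_Ioo.preimage (measurable_pi_apply i))

lemma measurableSet_ordered_interlace_right {m n : ℕ} (x : Fin n → ℝ) :
    MeasurableSet {y : Fin m → ℝ | y ∈ orderedPoints m ∧ Interlace x y} :=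
  (measurableSet_orderedPoints m).inter
    (measurableSet_setOfPred.2 (measurable_interlace measurable_const measurable_id))

/-- Integrating out the slice at time `t - 1`. -/
lemma exists_lintegral_leftWeight {M N : ℕ} (hMN : M ≤ N) {α η θ : ℝ} (hη : 0 ≤ η) (hθ : 0 ≤ θ)
    (hc : 0 < centralRate α η θ) (s t : Time M N) (hst : (t : ℤ) = s + 1) :
    ∃ C : ℝ, 0 < C ∧ ∀ x ∈ orderedPoints (len M N t),
      ∫⁻ y in {y : Fin (len M N s) → ℝ | y ∈ orderedPoints (len M N s) ∧ LinkRel t y x},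
        ENNReal.ofReal (vdm η y * ∏ i, (y i ^ (rate α η θ s - 1) *
          leftWeight M N α η θ s (y i))) =
        ENNReal.ofReal (C * (vdm η x * ∏ i, leftWeight M N α η θ t (x i))) := by
  have hs1 := s.2.1
  have ht2 := t.2.2
  by_cases ht : (t : ℤ) ≤ 0
  · have hlen : len M N t = len M N s + 1 := by
      unfold len
      rw [if_pos ht, if_pos (by omega)]
      omega
    obtain ⟨C, hC, h⟩ := exists_lintegral_interlace_lt hη hlen
    refine ⟨C, hC, fun x hx => ?_⟩
    have hs0 : (s : ℤ) < 0 := by omega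
    simp only [LinkRel, ht, if_true, rate, hs0, leftWeight, hs0.le, mul_one,
      Finset.prod_const_one]
    exact h x hx
  · -- from time `0` on, the surviving weight at time `s` is `u ^ (c - 1) ψ ^ m`
    have hs0 : 0 ≤ (s : ℤ) := by omega
    have hc' : 0 < centralRate α η θ + (s : ℝ) * θ := by
      have : (0 : ℝ) ≤ (s : ℤ) := by exact_mod_cast hs0
      positivity
    have hw : ∀ y ∈ orderedPoints (len M N s),
        ENNReal.ofReal (vdm η y * ∏ i, (y i ^ (rate α η θ s - 1) *
          leftWeight M N α η θ s (y i))) = ENNReal.ofReal (vdm η y *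
          ∏ i, (y i ^ (centralRate α η θ + (s : ℝ) * θ - 1) *
            powDiff η 1 (y i) ^ (M - (N - (s : ℤ).natAbs)))) := by
      intro y hy
      congr 2
      refine Finset.prod_congr rfl fun i _ => ?_
      unfold rate leftWeight
      rcases hs0.eq_or_lt with h | h
      · simp [← h, hMN]
      · rw [if_neg h.not_gt, if_neg h.ne', if_neg h.not_ge, ← mul_assoc,
          ← Real.rpow_add (hy.2 i).1]
        ring_nf
    have hcast : ((t : ℤ) : ℝ) - 1 = (s : ℤ) := by rw [hst]; push_cast; ring
    by_cases hN : (M : ℤ) ≤ N - t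
    · have hlen : len M N s = len M N t := by
        unfold len
        rw [if_neg ht]
        split_ifs <;> omega
      obtain ⟨C, hC, h⟩ := exists_lintegral_eq_interlace hc' hη hlen
      refine ⟨C, hC, fun x hx => ?_⟩
      have e1 : M - (N - (s : ℤ).natAbs) = 0 := by omega
      have e2 : M - (N - (t : ℤ).natAbs) = 0 := by omega
      simp only [LinkRel, ht, if_false]
      rw [setLIntegral_congr_ordered (measurableSet_ordered_interlace_right x) hw]
      simp only [e1, leftWeight, ht, if_false, e2, pow_zero, mul_one, hcast]
      exact h x hx
    · have hlen : len M N s = len M N t + 1 := by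
        unfold len
        rw [if_neg ht]
        split_ifs <;> omega
      obtain ⟨C, hC, h⟩ := exists_lintegral_lt_interlace hc' hη (M - (N - (s : ℤ).natAbs)) hlen
      refine ⟨C, hC, fun x hx => ?_⟩
      have e2 : M - (N - (t : ℤ).natAbs) = M - (N - (s : ℤ).natAbs) + 1 := by omega
      simp only [LinkRel, ht, if_false]
      rw [setLIntegral_congr_ordered (measurableSet_ordered_interlace_right x) hw]
      simp only [leftWeight, ht, if_false, e2, hcast]
      exact h x hx

/-- Integrating out the slice at time `s + 1`. -/
lemma exists_lintegral_rightWeight {M N : ℕ} (hMN : M ≤ N) {α η θ : ℝ} (hη : 0 ≤ η) (hθ : 0 ≤ θ)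
    (hc : 0 < centralRate α η θ) (s t : Time M N) (hst : (t : ℤ) = s + 1) :
    ∃ C : ℝ, 0 < C ∧ ∀ x ∈ orderedPoints (len M N s),
      ∫⁻ y in {y : Fin (len M N t) → ℝ | y ∈ orderedPoints (len M N t) ∧ LinkRel t x y},
        ENNReal.ofReal (vdm θ y * ∏ i, (y i ^ (rate α η θ t - 1) *
          rightWeight M N α η θ t (y i))) =
        ENNReal.ofReal (C * (vdm θ x * ∏ i, rightWeight M N α η θ s (x i))) := by
  have hs1 := s.2.1
  have ht2 := t.2.2
  by_cases ht : (t : ℤ) ≤ 0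
  · have hlen : len M N t = len M N s + 1 := by
      unfold len
      rw [if_pos ht, if_pos (by omega)]
      omega
    have hc' : 0 < centralRate α η θ + ((t : ℤ).natAbs : ℝ) * η := by positivity
    have hw : ∀ y ∈ orderedPoints (len M N t),
        ENNReal.ofReal (vdm θ y * ∏ i, (y i ^ (rate α η θ t - 1) *
          rightWeight M N α η θ t (y i))) = ENNReal.ofReal (vdm θ y *
          ∏ i, (y i ^ (centralRate α η θ + ((t : ℤ).natAbs : ℝ) * η - 1) *
            powDiff θ 1 (y i) ^ (N - (M - (t : ℤ).natAbs)))) := by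
      intro y hy
      congr 2
      refine Finset.prod_congr rfl fun i _ => ?_
      unfold rate rightWeight
      rcases ht.eq_or_lt with h | h
      · simp [h]
      · rw [if_pos h, if_neg h.not_ge, ← mul_assoc, ← Real.rpow_add (hy.2 i).1]
        ring_nf
    obtain ⟨C, hC, h⟩ := exists_lintegral_lt_interlace hc' hθ (N - (M - (t : ℤ).natAbs)) hlen
    refine ⟨C, hC, fun x hx => ?_⟩
    have hs0 : ¬ 0 ≤ (s : ℤ) := by omega
    have e2 : N - (M - (s : ℤ).natAbs) = N - (M - (t : ℤ).natAbs) + 1 := by omega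
    have hcast : ((s : ℤ).natAbs : ℝ) - 1 = (t : ℤ).natAbs := by
      have : (s : ℤ).natAbs = (t : ℤ).natAbs + 1 := by omega
      rw [this]; push_cast; ring
    simp only [LinkRel, ht, if_true]
    rw [setLIntegral_congr_ordered (measurableSet_ordered_interlace_right x) hw]
    simp only [rightWeight, hs0, if_false, e2, hcast]
    exact h x hx
  · have hs0 : 0 ≤ (s : ℤ) := by omega
    have ht0 : 0 ≤ (t : ℤ) := by omega
    have ht1 : ¬ (t : ℤ) < 0 := by omega
    have ht3 : ¬ (t : ℤ) = 0 := by omega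
    simp only [LinkRel, ht, if_false, rate, ht1, ht3, rightWeight, hs0, ht0, if_true]
    by_cases hN : (M : ℤ) ≤ N - t
    · have hlen : len M N s = len M N t := by
        unfold len
        rw [if_neg ht]
        split_ifs <;> omega
      have e2 : N - (s : ℤ).natAbs - M = N - (t : ℤ).natAbs - M + 1 := by omega
      rw [e2]
      exact exists_lintegral_interlace_eq hθ _ hlen
    · have hlen : len M N s = len M N t + 1 := by
        unfold len
        rw [if_neg ht]
        split_ifs <;> omega
      have e1 : N - (t : ℤ).natAbs - M = 0 := by omega
      have e2 : N - (s : ℤ).natAbs - M = 0 := by omega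
      simp only [e1, e2, pow_zero, mul_one, Finset.prod_const_one]
      exact exists_lintegral_interlace_lt hθ hlen

/-- A factor that does not depend on the integrated variables comes out of a marginal integral. -/
lemma lmarginal_mul_left {δ : Type*} [DecidableEq δ] {X : δ → Type*}
    [∀ i, MeasurableSpace (X i)] (μ : ∀ i, Measure (X i)) [∀ i, SigmaFinite (μ i)]
    {s : Finset δ} {f g : (∀ i, X i) → ℝ≥0∞} (hf : ∀ x y, (∀ i ∉ s, x i = y i) → f x = f y)
    (hg : Measurable g) (x : ∀ i, X i) :
    lmarginal μ s (fun x => f x * g x) x = f x * lmarginal μ s g x := by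
  unfold lmarginal
  have h : ∀ y : ∀ i : s, X i, f (Function.updateFinset x s y) = f x := fun y =>
    hf _ _ fun i hi => by simp [Function.updateFinset, hi]
  simp only [h]
  exact lintegral_const_mul _ (hg.comp measurable_updateFinset)

section Chain

variable {M N : ℕ} (α η θ : ℝ)

/-- The weight of the slice `x` at time `t`, which vanishes unless `x` is ordered. -/
noncomputable def sliceWeight (t : Time M N) (x : Fin (len M N t) → ℝ) : ℝ≥0∞ :=
  (orderedPoints (len M N t)).indicator
    (fun x => ENNReal.ofReal (∏ i, x i ^ (rate α η θ t - 1))) x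

/-- The trajectories that interlace between time `s` and time `s + 1`. -/
def linkSet (s : Time M N) : Set (Trajectory M N) :=
  {x | ∀ t : Time M N, (t : ℤ) = s + 1 → LinkRel t (x s) (x t)}

/-- The indicator function of `linkSet s`. -/
noncomputable def link (s : Time M N) : Trajectory M N → ℝ≥0∞ := (linkSet s).indicator 1

/-- The unnormalized density of the limiting process with respect to Lebesgue measure. -/
noncomputable def chainDensity (x : Trajectory M N) : ℝ≥0∞ :=
  (∏ s, sliceWeight α η θ s (x s)) * ∏ s, link s x

/-- The factors of `chainDensity` belonging to times before `t`. -/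
noncomputable def leftProd (t : Time M N) (x : Trajectory M N) : ℝ≥0∞ :=
  ∏ s with s < t, sliceWeight α η θ s (x s) * link s x

/-- The factors of `chainDensity` belonging to times after `t`. -/
noncomputable def rightProd (t : Time M N) (x : Trajectory M N) : ℝ≥0∞ :=
  (∏ s with t < s, sliceWeight α η θ s (x s)) * ∏ s with t ≤ s, link s x

lemma measurable_sliceWeight (t : Time M N) : Measurable (sliceWeight α η θ t) :=
  Measurable.indicator (by fun_prop) (measurableSet_orderedPoints _)

lemma measurableSet_linkSet (s : Time M N) : MeasurableSet (linkSet s) :=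
  measurableSet_setOfPred.2 (Measurable.forall fun t => measurable_const.imp
    (measurable_linkRel t (measurable_pi_apply s) (measurable_pi_apply t)))

lemma measurable_link (s : Time M N) : Measurable (link s) :=
  measurable_one.indicator (measurableSet_linkSet s)

lemma measurable_sliceWeight_comp (t : Time M N) :
    Measurable fun x : Trajectory M N => sliceWeight α η θ t (x t) :=
  (measurable_sliceWeight α η θ t).comp (measurable_pi_apply t)

lemma measurable_leftProd (t : Time M N) : Measurable (leftProd α η θ t) :=
  Finset.measurable_prod _ fun s _ => (measurable_sliceWeight_comp α η θ s).mul (measurable_link s)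

lemma measurable_rightProd (t : Time M N) : Measurable (rightProd α η θ t) :=
  (Finset.measurable_prod _ fun s _ => measurable_sliceWeight_comp α η θ s).mul
    (Finset.measurable_prod _ fun s _ => measurable_link s)

lemma measurable_chainDensity : Measurable (chainDensity (M := M) (N := N) α η θ) :=
  (Finset.measurable_prod _ fun s _ => measurable_sliceWeight_comp α η θ s).mul
    (Finset.measurable_prod _ fun s _ => measurable_link s)

lemma link_congr {s : Time M N} {x y : Trajectory M N} (hs : x s = y s)
    (h : ∀ t : Time M N, (t : ℤ) = s + 1 → x t = y t) : link s x = link s y := by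
  have : x ∈ linkSet s ↔ y ∈ linkSet s := by
    unfold linkSet
    refine forall_congr' fun t => forall_congr' fun ht => ?_
    rw [hs, h t ht]
  unfold link
  by_cases hx : x ∈ linkSet s
  · rw [Set.indicator_of_mem hx, Set.indicator_of_mem (this.1 hx)]; rfl
  · rw [Set.indicator_of_notMem hx, Set.indicator_of_notMem (mt this.2 hx)]

lemma mem_linkSet_iff {s t : Time M N} (hst : (t : ℤ) = s + 1) {x : Trajectory M N} :
    x ∈ linkSet s ↔ LinkRel t (x s) (x t) :=
  ⟨fun h => h t hst, fun h t' ht' => by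
    obtain rfl : t' = t := Subtype.ext (ht'.trans hst.symm)
    exact h⟩

lemma filter_lt_eq_insert {s t : Time M N} (hst : (t : ℤ) = s + 1) :
    Finset.univ.filter (· < t) = insert s (Finset.univ.filter (· < s)) := by
  ext u
  simp only [Finset.mem_filter, Finset.mem_univ, true_and, Finset.mem_insert,
    ← Subtype.coe_lt_coe, ← Subtype.coe_inj]
  omega

lemma filter_gt_eq_insert {s t : Time M N} (hst : (t : ℤ) = s + 1) :
    Finset.univ.filter (s < ·) = insert t (Finset.univ.filter (t < ·)) := by
  ext u
  simp only [Finset.mem_filter, Finset.mem_univ, true_and, Finset.mem_insert,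
    ← Subtype.coe_lt_coe, ← Subtype.coe_inj]
  omega

lemma leftProd_succ {s t : Time M N} (hst : (t : ℤ) = s + 1) (x : Trajectory M N) :
    leftProd α η θ t x = (sliceWeight α η θ s (x s) * link s x) * leftProd α η θ s x := by
  unfold leftProd
  rw [filter_lt_eq_insert hst, Finset.prod_insert (by simp)]

lemma rightProd_pred {s t : Time M N} (hst : (t : ℤ) = s + 1) (x : Trajectory M N) :
    rightProd α η θ s x = (sliceWeight α η θ t (x t) * link s x) * rightProd α η θ t x := by
  unfold rightProd
  have h2 : (Finset.univ.filter (s ≤ ·)) = insert s (Finset.univ.filter (t ≤ ·)) := by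
    ext u
    simp only [Finset.mem_filter, Finset.mem_univ, true_and, Finset.mem_insert,
      ← Subtype.coe_le_coe, ← Subtype.coe_inj]
    omega
  rw [filter_gt_eq_insert hst, h2, Finset.prod_insert (by simp), Finset.prod_insert (by
    simp [← Subtype.coe_le_coe, hst])]
  ring

/-- The integrand for the slice `x u`, with the orderedness and interlacing conditions collected in
one indicator function; on ordered slices the factor `f` is the result of earlier integrations. -/
lemma sliceWeight_mul_link_mul_eq {s : Time M N} (u : Time M N) {x : Trajectory M N}
    {f : ℝ≥0∞} {F : (Fin (len M N u) → ℝ) → ℝ}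
    {p : (Fin (len M N u) → ℝ) → Prop} (hp : x ∈ linkSet s ↔ p (x u))
    (hf : x u ∈ orderedPoints (len M N u) → f = ENNReal.ofReal (F (x u))) :
    sliceWeight α η θ u (x u) * link s x * f =
      {y | y ∈ orderedPoints (len M N u) ∧ p y}.indicator
        (fun y => ENNReal.ofReal ((∏ i, y i ^ (rate α η θ u - 1)) * F y)) (x u) := by
  unfold sliceWeight link
  by_cases h1 : x u ∈ orderedPoints (len M N u)
  · by_cases h2 : p (x u)
    · rw [Set.indicator_of_mem h1, Set.indicator_of_mem (hp.2 h2),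
        Set.indicator_of_mem (by exact ⟨h1, h2⟩), hf h1, Pi.one_apply, mul_one,
        ENNReal.ofReal_mul (Finset.prod_nonneg fun i _ => Real.rpow_nonneg (h1.2 i).1.le _)]
    · rw [Set.indicator_of_notMem (mt hp.1 h2), Set.indicator_of_notMem (fun h => h2 h.2 :
        x u ∉ {y | y ∈ orderedPoints (len M N u) ∧ p y})]
      simp
  · rw [Set.indicator_of_notMem h1, Set.indicator_of_notMem (fun h => h1 h.1 :
      x u ∉ {y | y ∈ orderedPoints (len M N u) ∧ p y})]
    simp

variable {α η θ}

lemma len_first (hM : 1 ≤ M) {t : Time M N} (ht : (t : ℤ) = -(M : ℤ) + 1) : len M N t = 1 := by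
  unfold len; rw [if_pos (by omega)]; omega

lemma len_last (hM : 1 ≤ M) (hMN : M ≤ N) {t : Time M N} (ht : (t : ℤ) = (N : ℤ) - 1) :
    len M N t = 1 := by
  unfold len; split_ifs <;> omega

lemma vdm_of_le_one (κ : ℝ) {n : ℕ} (hn : n ≤ 1) (x : Fin n → ℝ) : vdm κ x = 1 := by
  unfold vdm
  refine Finset.prod_eq_one fun i _ => ?_
  have : Finset.Ioi i = ∅ := by
    ext j; simp only [Finset.mem_Ioi, Finset.notMem_empty, iff_false, Fin.lt_def]; omega
  rw [this, Finset.prod_empty]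

/-- Integrating out all slices before time `t`, by induction on `t`; each step is a one-step
integral over interlacing configurations. -/
lemma exists_lmarginal_leftProd (hM : 1 ≤ M) (hMN : M ≤ N) (hη : 0 ≤ η) (hθ : 0 ≤ θ)
    (hc : 0 < centralRate α η θ) (t : Time M N) :
    ∃ C : ℝ, 0 < C ∧ ∀ x : Trajectory M N, x t ∈ orderedPoints (len M N t) →
      lmarginal (fun _ => volume) (Finset.univ.filter (· < t)) (leftProd α η θ t) x =
        ENNReal.ofReal (C * (vdm η (x t) * ∏ i, leftWeight M N α η θ t (x t i))) := by
  induction t using time_induction_up with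
  | h0 t ht =>
    refine ⟨1, one_pos, fun x _ => ?_⟩
    have h1 : (Finset.univ.filter (· < t)) = ∅ := by
      ext u
      have := u.2.1
      simp only [Finset.mem_filter, Finset.mem_univ, true_and, ← Subtype.coe_lt_coe,
        Finset.notMem_empty, iff_false]
      omega
    have h2 : (t : ℤ) ≤ 0 := by omega
    have h3 : leftProd α η θ t = fun _ => 1 := by
      funext x; unfold leftProd; rw [h1, Finset.prod_empty]
    rw [h1, lmarginal_empty, h3, vdm_of_le_one η (len_first hM ht).le]
    simp [leftWeight, h2]
  | h1 s t hst ih =>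
    obtain ⟨C, hC, ih⟩ := ih
    obtain ⟨C', hC', h⟩ := exists_lintegral_leftWeight hMN hη hθ hc s t hst
    refine ⟨C * C', mul_pos hC hC', fun x hx => ?_⟩
    have hne : t ≠ s := fun e => by rw [e] at hst; omega
    rw [filter_lt_eq_insert hst, lmarginal_insert _ (measurable_leftProd α η θ t) (by simp)]
    have h2 : ∀ y : Fin (len M N s) → ℝ, lmarginal (fun _ => volume)
        (Finset.univ.filter (· < s)) (leftProd α η θ t) (Function.update x s y) =
        {y | y ∈ orderedPoints (len M N s) ∧ LinkRel t y (x t)}.indicator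
          (fun y => ENNReal.ofReal ((∏ i, y i ^ (rate α η θ s - 1)) *
            (C * (vdm η y * ∏ i, leftWeight M N α η θ s (y i))))) y := by
      intro y
      have e1 : leftProd α η θ t = fun x => (sliceWeight α η θ s (x s) * link s x) *
        leftProd α η θ s x := funext fun x => leftProd_succ α η θ hst x
      have e2 : ∀ x y : Trajectory M N, (∀ i ∉ Finset.univ.filter (· < s), x i = y i) →
          sliceWeight α η θ s (x s) * link s x = sliceWeight α η θ s (y s) * link s y := by
        intro x y hxy
        rw [hxy s (by simp), link_congr (hxy s (by simp)) fun t ht => hxy t (by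
          simp [← Subtype.coe_le_coe, ht])]
      rw [e1, lmarginal_mul_left _ e2 (measurable_leftProd α η θ s)]
      have := sliceWeight_mul_link_mul_eq α η θ s (s := s) (x := Function.update x s y)
        (f := lmarginal (fun _ => volume) (Finset.univ.filter (· < s)) (leftProd α η θ s)
          (Function.update x s y))
        (F := fun y => C * (vdm η y * ∏ i, leftWeight M N α η θ s (y i)))
        (p := fun y => LinkRel t y (x t))
        (by rw [mem_linkSet_iff hst, Function.update_of_ne hne]) (fun hy => ih _ hy)
      rw [this, Function.update_self]
    simp only [h2]
    have hm : MeasurableSet {y | y ∈ orderedPoints (len M N s) ∧ LinkRel t y (x t)} :=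
      (measurableSet_orderedPoints _).inter
        (measurableSet_setOfPred.2 (measurable_linkRel t measurable_id measurable_const))
    rw [lintegral_indicator hm]
    have h3 : ∀ y : Fin (len M N s) → ℝ, ENNReal.ofReal ((∏ i, y i ^ (rate α η θ s - 1)) *
            (C * (vdm η y * ∏ i, leftWeight M N α η θ s (y i)))) = ENNReal.ofReal C *
          ENNReal.ofReal (vdm η y * ∏ i, (y i ^ (rate α η θ s - 1) *
          leftWeight M N α η θ s (y i))) := by
      intro y
      rw [← ENNReal.ofReal_mul hC.le, Finset.prod_mul_distrib]
      ring_nf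
    simp only [h3]
    rw [lintegral_const_mul' _ _ ENNReal.ofReal_ne_top, h _ hx, ← ENNReal.ofReal_mul hC.le,
      mul_assoc]

/-- Integrating out all slices after time `t`. -/
lemma exists_lmarginal_rightProd (hM : 1 ≤ M) (hMN : M ≤ N) (hη : 0 ≤ η) (hθ : 0 ≤ θ)
    (hc : 0 < centralRate α η θ) (t : Time M N) :
    ∃ C : ℝ, 0 < C ∧ ∀ x : Trajectory M N, x t ∈ orderedPoints (len M N t) →
      lmarginal (fun _ => volume) (Finset.univ.filter (t < ·)) (rightProd α η θ t) x =
        ENNReal.ofReal (C * (vdm θ (x t) * ∏ i, rightWeight M N α η θ t (x t i))) := by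
  induction t using time_induction_down with
  | h0 t ht =>
    -- The link condition at the last time is vacuous.
    refine ⟨1, one_pos, fun x _ => ?_⟩
    have h1 : (Finset.univ.filter (t < ·)) = ∅ := by
      ext u
      have := u.2.2
      simp only [Finset.mem_filter, Finset.mem_univ, true_and, ← Subtype.coe_lt_coe,
        Finset.notMem_empty, iff_false]
      omega
    have h2 : 0 ≤ (t : ℤ) := by omega
    have h3 : N - (t : ℤ).natAbs - M = 0 := by omega
    have h4 : rightProd α η θ t = fun _ => 1 := by
      funext x
      unfold rightProd
      rw [h1, Finset.prod_empty, one_mul]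
      refine Finset.prod_eq_one fun s hs => ?_
      refine Set.indicator_of_mem (fun u hu => absurd hu ?_) _
      have := u.2.2
      have hs := (Finset.mem_filter.1 hs).2
      rw [← Subtype.coe_le_coe] at hs
      omega
    rw [h1, lmarginal_empty, h4, vdm_of_le_one θ (len_last hM hMN ht).le]
    simp [rightWeight, h2, h3]
  | h1 t s hst ih =>
    obtain ⟨C, hC, ih⟩ := ih
    obtain ⟨C', hC', h⟩ := exists_lintegral_rightWeight hMN hη hθ hc t s hst
    refine ⟨C * C', mul_pos hC hC', fun x hx => ?_⟩
    have hne : t ≠ s := fun e => by rw [e] at hst; omega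
    rw [filter_gt_eq_insert hst, lmarginal_insert _ (measurable_rightProd α η θ t) (by simp)]
    have h2 : ∀ y : Fin (len M N s) → ℝ, lmarginal (fun _ => volume)
        (Finset.univ.filter (s < ·)) (rightProd α η θ t) (Function.update x s y) =
        {y | y ∈ orderedPoints (len M N s) ∧ LinkRel s (x t) y}.indicator
          (fun y => ENNReal.ofReal ((∏ i, y i ^ (rate α η θ s - 1)) *
            (C * (vdm θ y * ∏ i, rightWeight M N α η θ s (y i))))) y := by
      intro y
      have e1 : rightProd α η θ t = fun x => (sliceWeight α η θ s (x s) * link t x) *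
        rightProd α η θ s x := funext fun x => rightProd_pred α η θ hst x
      have e2 : ∀ x y : Trajectory M N, (∀ i ∉ Finset.univ.filter (s < ·), x i = y i) →
          sliceWeight α η θ s (x s) * link t x = sliceWeight α η θ s (y s) * link t y := by
        intro x y hxy
        rw [hxy s (by simp), link_congr (hxy t (by
          simp [← Subtype.coe_le_coe, hst])) fun u hu => hxy u (by
          simp [← Subtype.coe_le_coe, hst, hu])]
      rw [e1, lmarginal_mul_left _ e2 (measurable_rightProd α η θ s)]
      have := sliceWeight_mul_link_mul_eq α η θ s (s := t) (x := Function.update x s y)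
        (f := lmarginal (fun _ => volume) (Finset.univ.filter (s < ·)) (rightProd α η θ s)
          (Function.update x s y))
        (F := fun y => C * (vdm θ y * ∏ i, rightWeight M N α η θ s (y i)))
        (p := fun y => LinkRel s (x t) y)
        (by rw [mem_linkSet_iff hst, Function.update_of_ne hne]) (fun hy => ih _ hy)
      rw [this, Function.update_self]
    simp only [h2]
    have hm : MeasurableSet {y | y ∈ orderedPoints (len M N s) ∧ LinkRel s (x t) y} :=
      (measurableSet_orderedPoints _).inter
        (measurableSet_setOfPred.2 (measurable_linkRel s measurable_const measurable_id))
    rw [lintegral_indicator hm]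
    have h3 : ∀ y : Fin (len M N s) → ℝ, ENNReal.ofReal ((∏ i, y i ^ (rate α η θ s - 1)) *
            (C * (vdm θ y * ∏ i, rightWeight M N α η θ s (y i)))) = ENNReal.ofReal C *
          ENNReal.ofReal (vdm θ y * ∏ i, (y i ^ (rate α η θ s - 1) *
          rightWeight M N α η θ s (y i))) := by
      intro y
      rw [← ENNReal.ofReal_mul hC.le, Finset.prod_mul_distrib]
      ring_nf
    simp only [h3]
    rw [lintegral_const_mul' _ _ ENNReal.ofReal_ne_top, h _ hx, ← ENNReal.ofReal_mul hC.le,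
      mul_assoc]

lemma rpow_mul_leftWeight_mul_rightWeight (t : Time M N) {u : ℝ} (hu : 0 < u) :
    u ^ (rate α η θ t - 1) * leftWeight M N α η θ t u * rightWeight M N α η θ t u =
      weightC M N α η θ t u := by
  have ht1 := t.2.1
  have ht2 := t.2.2
  unfold rate leftWeight rightWeight weightC
  rcases lt_trichotomy (t : ℤ) 0 with h | h | h
  · rw [if_pos h, if_pos h.le, if_neg h.not_ge, if_pos h.le, mul_one, ← mul_assoc,
      ← Real.rpow_add hu]
    unfold centralRate
    ring_nf
  · simp [h, centralRate]
  · rw [if_neg h.not_gt, if_neg h.ne', if_neg h.not_ge, if_pos h.le, if_neg h.not_ge, ← mul_assoc,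
      ← Real.rpow_add hu]
    have e : θ - 1 + (centralRate α η θ + (((t : ℤ) : ℝ) - 1) * θ) =
        α + (η + θ) / 2 + ((t : ℤ) : ℝ) * θ - 1 := by unfold centralRate; ring
    rw [e]
    split_ifs with h'
    · have : M - (N - (t : ℤ).natAbs) = 0 := by omega
      simp [this]
    · have : N - (t : ℤ).natAbs - M = 0 := by omega
      simp [this]

lemma mbDensity_eq (t : Time M N) {x : Fin (len M N t) → ℝ}
    (hx : x ∈ orderedPoints (len M N t)) :
    mbDensity M N α η θ t x = (∏ i, x i ^ (rate α η θ t - 1)) *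
      (vdm η x * ∏ i, leftWeight M N α η θ t (x i)) *
      (vdm θ x * ∏ i, rightWeight M N α η θ t (x i)) := by
  unfold mbDensity
  have h1 : ∀ i, weightC M N α η θ t (x i) = _ := fun i =>
    (rpow_mul_leftWeight_mul_rightWeight t (hx.2 i).1).symm
  simp only [h1, Finset.prod_mul_distrib, vdm]
  ring

lemma measurable_mbDensity (t : ℤ) : Measurable (mbDensity M N α η θ t) := by
  unfold mbDensity weightC powDiff
  split_ifs <;> fun_prop

lemma chainDensity_eq (t : Time M N) (x : Trajectory M N) :
    chainDensity α η θ x =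
      sliceWeight α η θ t (x t) * leftProd α η θ t x * rightProd α η θ t x := by
  unfold chainDensity leftProd rightProd
  have h1 : (Finset.univ : Finset (Time M N)) =
      insert t (Finset.univ.filter (· < t) ∪ Finset.univ.filter (t < ·)) := by
    ext u
    simpa [or_left_comm] using lt_trichotomy u t
  have h2 : (Finset.univ : Finset (Time M N)) =
      Finset.univ.filter (· < t) ∪ Finset.univ.filter (t ≤ ·) := by
    ext u
    simpa using lt_or_ge u t
  have e1 : ∏ s, sliceWeight α η θ s (x s) = sliceWeight α η θ t (x t) *
      ((∏ s with s < t, sliceWeight α η θ s (x s)) *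
        ∏ s with t < s, sliceWeight α η θ s (x s)) := by
    conv_lhs => rw [h1]
    rw [Finset.prod_insert (by simp), Finset.prod_union]
    rw [Finset.disjoint_filter]
    exact fun u _ h h' => lt_asymm h h'
  have e2 : ∏ s, link s x = (∏ s with s < t, link s x) * ∏ s with t ≤ s, link s x := by
    conv_lhs => rw [h2]
    rw [Finset.prod_union]
    rw [Finset.disjoint_filter]
    exact fun u _ h h' => h.not_ge h'
  rw [e1, e2, Finset.prod_mul_distrib]
  ring

/-- The marginal of `chainDensity` at time `t` is proportional to the Muttalib--Borodin density. -/
lemma exists_lintegral_mul_chainDensity (hM : 1 ≤ M) (hMN : M ≤ N) (hη : 0 ≤ η) (hθ : 0 ≤ θ)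
    (hc : 0 < centralRate α η θ) (t : Time M N) :
    ∃ C : ℝ, 0 < C ∧ ∀ h : (Fin (len M N t) → ℝ) → ℝ≥0∞, Measurable h →
      ∫⁻ x : Trajectory M N, h (x t) * chainDensity α η θ x =
        ENNReal.ofReal C * ∫⁻ y, h y ∂(mbMeasure M N α η θ t) := by
  obtain ⟨C₁, hC₁, hl⟩ := exists_lmarginal_leftProd hM hMN hη hθ hc t
  obtain ⟨C₂, hC₂, hr⟩ := exists_lmarginal_rightProd hM hMN hη hθ hc t
  refine ⟨C₁ * C₂, mul_pos hC₁ hC₂, fun h hh => ?_⟩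
  set A := Finset.univ.filter (· < t) with hA
  set B := Finset.univ.filter (t < ·) with hB
  have hAB : Disjoint A B := by
    rw [hA, hB, Finset.disjoint_filter]
    exact fun u _ h h' => lt_asymm h h'
  have huniv : (Finset.univ : Finset (Time M N)) = insert t (A ∪ B) := by
    ext u
    simpa [hA, hB, or_left_comm] using lt_trichotomy u t
  have htA : t ∉ A := by simp [hA]
  have htB : t ∉ B := by simp [hB]
  let L : (Fin (len M N t) → ℝ) → ℝ := fun y =>
    C₁ * (vdm η y * ∏ i, leftWeight M N α η θ t (y i))
  let R : (Fin (len M N t) → ℝ) → ℝ := fun y =>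
    C₂ * (vdm θ y * ∏ i, rightWeight M N α η θ t (y i))
  have hhm : Measurable fun x : Trajectory M N => h (x t) := hh.comp (measurable_pi_apply t)
  have hfm : Measurable fun x : Trajectory M N => h (x t) * chainDensity α η θ x :=
    hhm.mul (measurable_chainDensity α η θ)
  -- The density splits at time `t`; the factor after `t` is integrated first, and the result
  -- depends on `x t` alone, so that it comes out of the integral over the slices before `t`.
  have hBint : lmarginal (fun _ => volume) B
      (fun x : Trajectory M N => h (x t) * chainDensity α η θ x) = fun x =>
        (h (x t) * sliceWeight α η θ t (x t) * ENNReal.ofReal (R (x t))) *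
          leftProd α η θ t x := by
    funext x
    have e1 : (fun x : Trajectory M N => h (x t) * chainDensity α η θ x) = fun x =>
        (h (x t) * sliceWeight α η θ t (x t) * leftProd α η θ t x) * rightProd α η θ t x := by
      funext x; rw [chainDensity_eq t]; ring
    rw [e1, lmarginal_mul_left _ (fun x y hxy => ?_) (measurable_rightProd α η θ t)]
    · by_cases hx : x t ∈ orderedPoints (len M N t)
      · rw [hr x hx]; ring
      · simp [sliceWeight, hx]
    · have e2 : leftProd α η θ t x = leftProd α η θ t y := by
        unfold leftProd
        refine Finset.prod_congr rfl fun s hs => ?_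
        have hs := (Finset.mem_filter.1 hs).2
        rw [hxy s (by simpa [hB] using hs.le), link_congr (hxy s (by simpa [hB] using hs.le))
          fun u hu => hxy u (by
            rw [← Subtype.coe_lt_coe] at hs
            simp only [hB, Finset.mem_filter, Finset.mem_univ, true_and, ← Subtype.coe_lt_coe]
            omega)]
      rw [hxy t htB, e2]
  have hABint : lmarginal (fun _ => volume) (A ∪ B)
      (fun x : Trajectory M N => h (x t) * chainDensity α η θ x) = fun x =>
        h (x t) * sliceWeight α η θ t (x t) * ENNReal.ofReal (R (x t)) *
          ENNReal.ofReal (L (x t)) := by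
    rw [lmarginal_union _ _ hfm hAB, hBint]
    funext x
    rw [lmarginal_mul_left _ (fun x y hxy => by rw [hxy t htA]) (measurable_leftProd α η θ t)]
    by_cases hx : x t ∈ orderedPoints (len M N t)
    · rw [hl x hx]
    · simp [sliceWeight, hx]
  have hlast : ∀ y : Fin (len M N t) → ℝ, h y * sliceWeight α η θ t y * ENNReal.ofReal (R y) *
      ENNReal.ofReal (L y) = (orderedPoints (len M N t)).indicator (fun y =>
        ENNReal.ofReal (C₁ * C₂) * (ENNReal.ofReal (mbDensity M N α η θ t y) * h y)) y := by
    intro y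
    by_cases hy : y ∈ orderedPoints (len M N t)
    · have hw : 0 ≤ ∏ i, y i ^ (rate α η θ t - 1) :=
        Finset.prod_nonneg fun i _ => Real.rpow_nonneg (hy.2 i).1.le _
      have hL : 0 ≤ L y := by
        refine mul_nonneg hC₁.le (mul_nonneg (vdm_pos hη hy.1 fun i => (hy.2 i).1).le
          (Finset.prod_nonneg fun i _ => ?_))
        unfold leftWeight
        split_ifs
        · exact zero_le_one
        · exact weight_nonneg hη _ _ (hy.2 i).1 (hy.2 i).2
      rw [Set.indicator_of_mem hy, sliceWeight, Set.indicator_of_mem hy, mul_assoc, mul_assoc,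
        mul_comm (ENNReal.ofReal (R y)), ← ENNReal.ofReal_mul hL, ← ENNReal.ofReal_mul hw,
        mul_comm (h y), ← mul_assoc (ENNReal.ofReal (C₁ * C₂)), ← mul_assoc,
        ← ENNReal.ofReal_mul (mul_pos hC₁ hC₂).le, mbDensity_eq t hy]
      congr 2
      simp only [L, R]
      ring
    · simp [sliceWeight, hy]
  obtain ⟨x₀⟩ : Nonempty (Trajectory M N) := ⟨fun _ _ => 0⟩
  rw [volume_pi, lintegral_eq_lmarginal_univ x₀, huniv, lmarginal_insert _ hfm (by
    simp [htA, htB]), hABint]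
  simp only [Function.update_self, hlast]
  rw [lintegral_indicator (measurableSet_orderedPoints _),
    lintegral_const_mul' _ _ ENNReal.ofReal_ne_top, mbMeasure,
    lintegral_withDensity_eq_lintegral_mul₀' _ hh.aemeasurable]
  · rfl
  · exact (measurable_mbDensity t).ennreal_ofReal.aemeasurable

end Chain

/-! ### Plane partitions as interlacing arrays of slices -/

section Slices

variable {M N : ℕ}

/-- Arrays of natural numbers of the shape of the slices of a plane partition. -/
abbrev SliceArray (M N : ℕ) : Type := (t : Time M N) → Fin (len M N t) → ℕ

/-- The array of all slices of a plane partition. -/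
def slices (Λ : PlanePartition M N) : SliceArray M N := fun t k => Λ.slice t k

/-- The weak interlacing `x_1 ≥ y_1 ≥ x_2 ≥ y_2 ≥ ⋯` of the parts of two partitions. -/
def WeakInterlace {R : Type*} [LE R] {m n : ℕ} (y : Fin m → R) (x : Fin n → R) : Prop :=
  (∀ (i : Fin n) (j : Fin m), (i : ℕ) = j → y j ≤ x i) ∧
  (∀ (i : Fin n) (j : Fin m), (i : ℕ) = j + 1 → x i ≤ y j)

/-- Weak interlacing of the slices `y` at time `t - 1` and `x` at time `t`. -/
def WeakLinkRel {R : Type*} [LE R] {m n : ℕ} (t : ℤ) (y : Fin m → R) (x : Fin n → R) : Prop :=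
  if t ≤ 0 then WeakInterlace y x else WeakInterlace x y

lemma PlanePartition.ext_height {Λ Λ' : PlanePartition M N} (h : Λ.height = Λ'.height) :
    Λ = Λ' := by
  cases Λ; cases Λ'; cases h; rfl

/-- The time of the diagonal through the cell `(i, j)`. -/
def cellTime {i j : ℕ} (hi : i < M) (hj : j < N) : Time M N := ⟨(j : ℤ) - i, by omega, by omega⟩

lemma min_lt_len {i j : ℕ} (hi : i < M) (hj : j < N) :
    min i j < len M N (cellTime hi hj) := by
  unfold len cellTime
  simp only
  split_ifs <;> omega

lemma slices_cell (Λ : PlanePartition M N) {i j : ℕ} (hi : i < M) (hj : j < N) :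
    slices Λ (cellTime hi hj) ⟨min i j, min_lt_len hi hj⟩ = Λ.height i j := by
  unfold slices PlanePartition.slice cellTime
  simp only
  split_ifs with h
  · congr 1 <;> omega
  · congr 1 <;> omega

lemma slices_injective : Function.Injective (slices (M := M) (N := N)) := by
  intro Λ Λ' h
  refine PlanePartition.ext_height (funext fun i => funext fun j => ?_)
  by_cases hij : i < M ∧ j < N
  · rw [← slices_cell Λ hij.1 hij.2, h, slices_cell]
  · rw [Λ.height_eq_zero i j (by omega), Λ'.height_eq_zero i j (by omega)]

instance : Countable (PlanePartition M N) := slices_injective.countable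

instance : MeasurableSingletonClass (PlanePartition M N) := ⟨fun _ => trivial⟩

lemma PlanePartition.height_anti (Λ : PlanePartition M N) {i i' j j' : ℕ} (hi : i ≤ i')
    (hj : j ≤ j') : Λ.height i' j' ≤ Λ.height i j :=
  (antitone_nat_of_succ_le (f := fun i => Λ.height i j') (fun i => Λ.anti_col i j') hi).trans
    (antitone_nat_of_succ_le (fun j => Λ.anti_row i j) hj)

lemma slices_anti (Λ : PlanePartition M N) (t : Time M N) {k l : Fin (len M N t)} (h : k ≤ l) :
    slices Λ t l ≤ slices Λ t k := by
  have h : (k : ℕ) ≤ l := h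
  unfold slices PlanePartition.slice
  split_ifs <;> exact Λ.height_anti (by omega) (by omega)

lemma weakLinkRel_slices (Λ : PlanePartition M N) {s t : Time M N} (hst : (t : ℤ) = s + 1) :
    WeakLinkRel t (slices Λ s) (slices Λ t) := by
  unfold WeakLinkRel WeakInterlace slices PlanePartition.slice
  split_ifs <;> first | omega | exact
    ⟨fun i j h => Λ.height_anti (by omega) (by omega),
      fun i j h => Λ.height_anti (by omega) (by omega)⟩

open Classical in
/-- The heights of the plane partition with a given array of slices. -/
noncomputable def heightOfSlices (y : SliceArray M N) (i j : ℕ) : ℕ :=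
  if h : i < M ∧ j < N then y (cellTime h.1 h.2) ⟨min i j, min_lt_len h.1 h.2⟩ else 0

lemma heightOfSlices_eq (y : SliceArray M N) {i j : ℕ} (t : Time M N) (k : Fin (len M N t))
    (ht : (t : ℤ) = j - i) (hk : (k : ℕ) = min i j) (hi : i < M) (hj : j < N) :
    heightOfSlices y i j = y t k := by
  unfold heightOfSlices
  rw [dif_pos ⟨hi, hj⟩]
  obtain rfl : t = cellTime hi hj := Subtype.ext ht
  congr 1
  exact Fin.ext hk.symm

/-- The slices of plane partitions are exactly the weakly interlacing arrays. -/
lemma mem_range_slices (hMN : M ≤ N) {y : SliceArray M N}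
    (h : ∀ s t : Time M N, (t : ℤ) = s + 1 → WeakLinkRel t (y s) (y t)) :
    y ∈ Set.range slices := by
  have hrow : ∀ i j, heightOfSlices y i (j + 1) ≤ heightOfSlices y i j := by
    intro i j
    by_cases hij : i < M ∧ j + 1 < N
    swap
    · unfold heightOfSlices
      rw [dif_neg hij]
      exact Nat.zero_le _
    have h1 := h (cellTime hij.1 (Nat.lt_of_succ_lt hij.2)) (cellTime hij.1 hij.2)
      (by simp only [cellTime]; push_cast; ring)
    have e1 := heightOfSlices_eq y (cellTime hij.1 hij.2) ⟨_, min_lt_len hij.1 hij.2⟩ rfl rfl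
      hij.1 hij.2
    have e2 := heightOfSlices_eq y (cellTime hij.1 (Nat.lt_of_succ_lt hij.2))
      ⟨_, min_lt_len hij.1 (Nat.lt_of_succ_lt hij.2)⟩ rfl rfl hij.1 (Nat.lt_of_succ_lt hij.2)
    rw [e1, e2]
    unfold WeakLinkRel WeakInterlace at h1
    split_ifs at h1 with h0
    · simp only [cellTime] at h0
      exact h1.2 _ _ (by simp only; omega)
    · simp only [cellTime] at h0
      exact h1.1 _ _ (by simp only; omega)
  have hcol : ∀ i j, heightOfSlices y (i + 1) j ≤ heightOfSlices y i j := by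
    intro i j
    by_cases hij : i + 1 < M ∧ j < N
    swap
    · unfold heightOfSlices
      rw [dif_neg hij]
      exact Nat.zero_le _
    have h1 := h (cellTime hij.1 hij.2) (cellTime (Nat.lt_of_succ_lt hij.1) hij.2)
      (by simp only [cellTime]; push_cast; ring)
    have e1 := heightOfSlices_eq y (cellTime hij.1 hij.2) ⟨_, min_lt_len hij.1 hij.2⟩ rfl rfl
      hij.1 hij.2
    have e2 := heightOfSlices_eq y (cellTime (Nat.lt_of_succ_lt hij.1) hij.2)
      ⟨_, min_lt_len (Nat.lt_of_succ_lt hij.1) hij.2⟩ rfl rfl (Nat.lt_of_succ_lt hij.1) hij.2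
    rw [e1, e2]
    unfold WeakLinkRel WeakInterlace at h1
    split_ifs at h1 with h0
    · simp only [cellTime] at h0
      exact h1.1 _ _ (by simp only; omega)
    · simp only [cellTime] at h0
      exact h1.2 _ _ (by simp only; omega)
  refine ⟨⟨heightOfSlices y, hrow, hcol, fun i j hij => ?_⟩, ?_⟩
  · unfold heightOfSlices
    rw [dif_neg (by omega)]
  · funext t k
    have ht1 := t.2.1
    have ht2 := t.2.2
    have hk := k.2
    unfold slices PlanePartition.slice
    by_cases h0 : (t : ℤ) ≤ 0
    · have hlen : len M N t = M - (t : ℤ).natAbs := if_pos h0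
      rw [if_pos h0]
      exact heightOfSlices_eq y t k (by omega) (by omega) (by omega) (by omega)
    · have hlen : len M N t = min (N - (t : ℤ).natAbs) M := if_neg h0
      rw [if_neg h0]
      exact heightOfSlices_eq y t k (by omega) (by omega) (by omega) (by omega)

/-- The exponent of the weight of an array of slices. -/
noncomputable def exponent (α η θ : ℝ) (y : SliceArray M N) : ℝ :=
  ∑ t : Time M N, ∑ k, rate α η θ t * (y t k : ℝ)

lemma sum_time (g : ℤ → ℝ) (h1 : g (-(M : ℤ)) = 0) (h2 : g N = 0) (hM : 1 ≤ M) (hN : 1 ≤ N) :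
    ∑ t : Time M N, g t =
      (∑ t ∈ Finset.Icc (-(M : ℤ)) (-1), g t) + g 0 + ∑ t ∈ Finset.Icc (1 : ℤ) N, g t := by
  have e1 : ∑ t : Time M N, g t = ∑ t ∈ Finset.Icc (-(M : ℤ) + 1) ((N : ℤ) - 1), g t :=
    (Finset.sum_subtype _ (fun x => Finset.mem_Icc) g).symm
  have e2 : ∑ t ∈ Finset.Icc (-(M : ℤ) + 1) ((N : ℤ) - 1), g t =
      ∑ t ∈ Finset.Icc (-(M : ℤ)) N, g t := by
    refine Finset.sum_subset (Finset.Icc_subset_Icc (by omega) (by omega)) fun t ht ht' => ?_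
    rw [Finset.mem_Icc] at ht ht'
    rcases (by omega : t = -(M : ℤ) ∨ t = N) with rfl | rfl
    · exact h1
    · exact h2
  have e3 : Finset.Icc (-(M : ℤ)) N =
      (Finset.Icc (-(M : ℤ)) (-1) ∪ {0}) ∪ Finset.Icc (1 : ℤ) N := by
    ext t
    simp only [Finset.mem_Icc, Finset.mem_union, Finset.mem_singleton]
    omega
  rw [e1, e2, e3, Finset.sum_union, Finset.sum_union, Finset.sum_singleton]
  · simp
  · rw [Finset.disjoint_left]
    intro t
    simp only [Finset.mem_Icc, Finset.mem_union, Finset.mem_singleton]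
    omega

lemma weight_eq_exp (hM : 1 ≤ M) (hN : 1 ≤ N) (α η θ ε : ℝ) (Λ : PlanePartition M N) :
    Λ.weight (Real.exp (-ε)) (Real.exp (-(α * ε))) η θ =
      Real.exp (-(ε * exponent α η θ (slices Λ))) := by
  have h1 : exponent α η θ (slices Λ) =
      η * Λ.leftVol + centralRate α η θ * Λ.centralVol + θ * Λ.rightVol := by
    have e : ∀ t : Time M N, ∑ k, rate α η θ t * (slices Λ t k : ℝ) =
        (fun t : ℤ => rate α η θ t * (Λ.sliceSize t : ℝ)) t := by
      intro t
      rw [← Finset.mul_sum]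
      simp only [PlanePartition.sliceSize, Nat.cast_sum, slices]
      rw [Finset.sum_range fun k => ((Λ.slice t k : ℕ) : ℝ)]
    unfold exponent
    simp only [e]
    rw [sum_time (fun t : ℤ => rate α η θ t * (Λ.sliceSize t : ℝ)) (by
        simp [PlanePartition.sliceSize, len]) (by
        have : ¬ N = 0 := by omega
        simp [PlanePartition.sliceSize, len, this]) hM hN]
    simp only [PlanePartition.leftVol, PlanePartition.rightVol, PlanePartition.centralVol,
      Nat.cast_sum, Finset.mul_sum]
    congr 1
    · refine congrArg₂ (· + ·) (Finset.sum_congr rfl fun t ht => ?_) (by simp [rate])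
      rw [Finset.mem_Icc] at ht
      rw [rate, if_pos (by omega)]
    · refine Finset.sum_congr rfl fun t ht => ?_
      rw [Finset.mem_Icc] at ht
      rw [rate, if_neg (by omega), if_neg (by omega)]
  rw [h1]
  unfold PlanePartition.weight centralRate
  rw [← Real.exp_mul, ← Real.exp_mul, ← Real.exp_mul, ← Real.exp_add, ← Real.exp_nat_mul,
    ← Real.exp_add, ← Real.exp_add]
  ring_nf

/-- The number of points of a trajectory. -/
noncomputable def numPoints (M N : ℕ) : ℕ := ∑ t : Time M N, len M N t

lemma numPoints_pos (hM : 1 ≤ M) (hN : 1 ≤ N) : 0 < numPoints M N := by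
  have hlen : 0 < len M N 0 := by simp [len]; omega
  exact hlen.trans_le (Finset.single_le_sum (f := fun t : Time M N => len M N t)
    (fun _ _ => Nat.zero_le _) (Finset.mem_univ (⟨0, by omega, by omega⟩ : Time M N)))

/-- The exponent of a plane partition controls the sum of all its entries, because the largest
entry lies on the central slice, whose rate is positive. -/
lemma exponent_lower_bound (hM : 1 ≤ M) (hN : 1 ≤ N) {α η θ : ℝ} (hη : 0 ≤ η) (hθ : 0 ≤ θ)
    (hc : 0 < centralRate α η θ) {y : SliceArray M N} (hy : y ∈ Set.range slices) :
    ∑ t, ∑ k, centralRate α η θ / numPoints M N * (y t k : ℝ) ≤ exponent α η θ y := by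
  obtain ⟨Λ, rfl⟩ := hy
  let t₀ : Time M N := ⟨0, by omega, by omega⟩
  have hlen : 0 < len M N t₀ := by simp [len, t₀]; omega
  let k₀ : Fin (len M N t₀) := ⟨0, hlen⟩
  have hn := numPoints_pos hM hN
  have hmax : ∀ t k, (slices Λ t k : ℝ) ≤ slices Λ t₀ k₀ := by
    intro t k
    have : slices Λ t k ≤ slices Λ t₀ k₀ := by
      unfold slices PlanePartition.slice
      simp only [t₀, k₀, le_refl, if_true, Int.natAbs_zero, add_zero]
      split_ifs <;> exact Λ.height_anti (Nat.zero_le _) (Nat.zero_le _)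
    exact_mod_cast this
  have hr : ∀ t : Time M N, 0 ≤ rate α η θ t := by
    intro t
    unfold rate
    split_ifs
    · exact hη
    · exact hc.le
    · exact hθ
  have hnn : ∀ t : Time M N, ∀ k, 0 ≤ rate α η θ t * (slices Λ t k : ℝ) := fun t k =>
    mul_nonneg (hr t) (Nat.cast_nonneg _)
  calc ∑ t, ∑ k, centralRate α η θ / numPoints M N * (slices Λ t k : ℝ)
      ≤ ∑ t : Time M N, ∑ _k : Fin (len M N t),
          centralRate α η θ / numPoints M N * (slices Λ t₀ k₀ : ℝ) := by
        gcongr with t _ k _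
        exact_mod_cast hmax t k
    _ = centralRate α η θ * (slices Λ t₀ k₀ : ℝ) := by
        have : (numPoints M N : ℝ) = ∑ t : Time M N, (len M N t : ℝ) := by simp [numPoints]
        have h0 : (numPoints M N : ℝ) ≠ 0 := by positivity
        simp only [Finset.sum_const, Finset.card_univ, Fintype.card_fin, nsmul_eq_mul]
        rw [← Finset.sum_mul, ← this]
        field_simp
    _ = rate α η θ t₀ * (slices Λ t₀ k₀ : ℝ) := by simp [rate, t₀]
    _ ≤ ∑ k, rate α η θ t₀ * (slices Λ t₀ k : ℝ) :=
        Finset.single_le_sum (f := fun k => rate α η θ t₀ * (slices Λ t₀ k : ℝ))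
          (fun k _ => hnn t₀ k) (Finset.mem_univ k₀)
    _ ≤ exponent α η θ (slices Λ) :=
        Finset.single_le_sum (f := fun t : Time M N => ∑ k, rate α η θ t * (slices Λ t k : ℝ))
          (fun t _ => Finset.sum_nonneg fun k _ => hnn t k) (Finset.mem_univ t₀)

end Slices

/-! ### Sums over slice arrays as integrals -/

/-- Tonelli's theorem for products of functions of one coordinate each. -/
lemma lintegral_pi_prod {ι : Type*} [Fintype ι] {X : ι → Type*} [∀ i, MeasurableSpace (X i)]
    (μ : ∀ i, Measure (X i)) [∀ i, SigmaFinite (μ i)] {f : ∀ i, X i → ℝ≥0∞}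
    (hf : ∀ i, Measurable (f i)) :
    ∫⁻ x, ∏ i, f i (x i) ∂(Measure.pi μ) = ∏ i, ∫⁻ y, f i y ∂(μ i) := by
  classical
  have hm : ∀ s : Finset ι, Measurable fun x : ∀ i, X i => ∏ i ∈ s, f i (x i) := fun s =>
    Finset.measurable_prod _ fun i _ => (hf i).comp (measurable_pi_apply i)
  have key : ∀ (s : Finset ι) (x : ∀ i, X i),
      lmarginal μ s (fun x => ∏ i ∈ s, f i (x i)) x = ∏ i ∈ s, ∫⁻ y, f i y ∂(μ i) := by
    intro s
    induction s using Finset.induction_on with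
    | empty => simp
    | insert i s hi ih =>
      intro x
      rw [lmarginal_insert _ (hm _) hi, Finset.prod_insert hi]
      have h1 : ∀ y : X i, lmarginal μ s (fun x => ∏ j ∈ insert i s, f j (x j))
          (Function.update x i y) = f i y * ∏ i ∈ s, ∫⁻ y, f i y ∂(μ i) := by
        intro y
        simp only [Finset.prod_insert hi]
        rw [lmarginal_mul_left μ (f := fun x => f i (x i)) (fun x y h => by rw [h i hi]) (hm s), ih]
        simp
      simp only [h1]
      exact lintegral_mul_const _ (hf i)
  rcases isEmpty_or_nonempty (∀ i, X i) with h | ⟨⟨x⟩⟩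
  · obtain ⟨i, hi⟩ := isEmpty_pi.1 h
    rw [lintegral_of_isEmpty]
    exact (Finset.prod_eq_zero (Finset.mem_univ i) (lintegral_of_isEmpty _ _)).symm
  · rw [lintegral_eq_lmarginal_univ x, key]

section Discretization

variable {M N : ℕ}

lemma measurable_trajectory_prod {f : ∀ t : Time M N, Fin (len M N t) → ℝ → ℝ≥0∞}
    (hf : ∀ t k, Measurable (f t k)) :
    Measurable fun x : Trajectory M N => ∏ t, ∏ k, f t k (x t k) :=
  Finset.measurable_prod _ fun t _ => Finset.measurable_prod _ fun k _ =>
    (hf t k).comp ((measurable_pi_apply k).comp (measurable_pi_apply t))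

lemma lintegral_trajectory_prod {f : ∀ t : Time M N, Fin (len M N t) → ℝ → ℝ≥0∞}
    (hf : ∀ t k, Measurable (f t k)) :
    ∫⁻ x : Trajectory M N, ∏ t, ∏ k, f t k (x t k) = ∏ t, ∏ k, ∫⁻ u, f t k u := by
  rw [volume_pi, lintegral_pi_prod _ (f := fun (t : Time M N) (y : Fin (len M N t) → ℝ) =>
    ∏ k, f t k (y k)) fun t =>
      Finset.measurable_prod _ fun k _ => (hf t k).comp (measurable_pi_apply k)]
  refine Finset.prod_congr rfl fun t _ => ?_
  rw [volume_pi, lintegral_pi_prod _ (hf t)]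

/-- The part of a partition that corresponds to the point `u` at scale `ε`. -/
noncomputable def disc (ε u : ℝ) : ℕ := ⌊-Real.log u / ε⌋₊

/-- The array of parts that corresponds to a trajectory at scale `ε`. -/
noncomputable def discTraj (ε : ℝ) (x : Trajectory M N) : SliceArray M N :=
  fun t k => disc ε (x t k)

/-- The density of the measure `du / u` on `(0, 1)`. -/
noncomputable def invWeight (u : ℝ) : ℝ≥0∞ :=
  (Set.Ioo (0 : ℝ) 1).indicator (fun u => ENNReal.ofReal u⁻¹) u

lemma measurable_disc (ε : ℝ) : Measurable (disc ε) :=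
  Nat.measurable_floor.comp ((Real.measurable_log.neg).div_const ε)

lemma measurable_discTraj (ε : ℝ) : Measurable (discTraj (M := M) (N := N) ε) := by
  refine measurable_pi_lambda _ fun t => measurable_pi_lambda _ fun k => ?_
  exact (measurable_disc ε).comp ((measurable_pi_apply k).comp (measurable_pi_apply t))

lemma measurable_invWeight : Measurable invWeight :=
  Measurable.indicator (by fun_prop) measurableSet_Ioo

lemma disc_anti {ε u v : ℝ} (hε : 0 < ε) (hu : 0 < u) (huv : u ≤ v) : disc ε v ≤ disc ε u := by
  unfold disc
  have := Real.log_le_log hu huv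
  gcongr

lemma neg_log_nonneg {u : ℝ} (hu : u ∈ Set.Ioo (0 : ℝ) 1) : 0 ≤ -Real.log u :=
  neg_nonneg.2 (Real.log_nonpos hu.1.le hu.2.le)

lemma mul_disc_le {ε u : ℝ} (hε : 0 < ε) (hu : u ∈ Set.Ioo (0 : ℝ) 1) :
    ε * disc ε u ≤ -Real.log u := by
  have := Nat.floor_le (div_nonneg (neg_log_nonneg hu) hε.le)
  unfold disc
  rwa [le_div_iff₀ hε, mul_comm] at this

lemma le_mul_disc {ε u : ℝ} (hε : 0 < ε) : -Real.log u - ε ≤ ε * disc ε u := by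
  have := (Nat.lt_floor_add_one (-Real.log u / ε)).le
  unfold disc
  rw [div_le_iff₀ hε] at this
  linarith

/-- The measure `du / u` gives mass `ε` to each fibre of the discretization. -/
lemma lintegral_invWeight_fiber {ε : ℝ} (hε : 0 < ε) (n : ℕ) :
    ∫⁻ u, invWeight u * (if disc ε u = n then 1 else 0) = ENNReal.ofReal ε := by
  set a := Real.exp (-((n + 1) * ε)) with ha
  set b := Real.exp (-(n * ε)) with hb
  have ha0 : 0 < a := Real.exp_pos _
  have hb0 : 0 < b := Real.exp_pos _
  have hab : a < b := Real.exp_lt_exp.2 (by nlinarith)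
  have hb1 : b ≤ 1 := Real.exp_le_one_iff.2 (by have : 0 ≤ n * ε := by positivity
                                                linarith)
  have hae : (fun u => invWeight u * (if disc ε u = n then 1 else 0)) =ᵐ[volume]
      (Set.Ioo a b).indicator fun u => ENNReal.ofReal u⁻¹ := by
    filter_upwards [compl_mem_ae_iff.2 (measure_singleton b)] with u hu
    have hu : u ≠ b := hu
    have hiff : u ∈ Set.Ioo (0 : ℝ) 1 → (disc ε u = n ↔ u ∈ Set.Ioo a b) := by
      intro h
      unfold disc
      rw [Nat.floor_eq_iff (div_nonneg (neg_log_nonneg h) hε.le), le_div_iff₀ hε, div_lt_iff₀ hε,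
        Set.mem_Ioo, ha, hb, ← Real.lt_log_iff_exp_lt h.1]
      constructor
      · rintro ⟨h1, h2⟩
        exact ⟨by linarith, lt_of_le_of_ne ((Real.log_le_iff_le_exp h.1).1 (by linarith)) hu⟩
      · rintro ⟨h1, h2⟩
        exact ⟨by have := (Real.log_le_iff_le_exp h.1).2 h2.le; linarith, by linarith⟩
    by_cases h : u ∈ Set.Ioo a b
    · have h01 : u ∈ Set.Ioo (0 : ℝ) 1 := ⟨ha0.trans h.1, h.2.trans_le hb1⟩
      rw [Set.indicator_of_mem h, invWeight, Set.indicator_of_mem h01, if_pos ((hiff h01).2 h),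
        mul_one]
    · rw [Set.indicator_of_notMem h]
      by_cases h01 : u ∈ Set.Ioo (0 : ℝ) 1
      · rw [if_neg (mt (hiff h01).1 h), mul_zero]
      · rw [invWeight, Set.indicator_of_notMem h01, zero_mul]
  have hint : IntervalIntegrable (fun u : ℝ => u⁻¹) volume a b :=
    intervalIntegral.intervalIntegrable_inv (fun u hu => by
      rw [Set.uIcc_of_le hab.le] at hu
      exact (ha0.trans_le hu.1).ne') continuousOn_id
  rw [lintegral_congr_ae hae, lintegral_indicator measurableSet_Ioo,
    ← ofReal_integral_eq_lintegral_ofReal]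
  · rw [← integral_Ioc_eq_integral_Ioo, ← intervalIntegral.integral_of_le hab.le,
      integral_inv_of_pos ha0 hb0, Real.log_div hb0.ne' ha0.ne', ha, hb, Real.log_exp,
      Real.log_exp]
    congr 1
    ring
  · exact (intervalIntegrable_iff_integrableOn_Ioo_of_le hab.le).1 hint
  · filter_upwards [ae_restrict_mem measurableSet_Ioo] with u hu
    exact inv_nonneg.2 (ha0.trans hu.1).le

/-- A sum over arrays of natural numbers is an integral over trajectories. -/
lemma lintegral_discTraj {ε : ℝ} (hε : 0 < ε) (F : SliceArray M N → ℝ≥0∞) :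
    ∫⁻ x : Trajectory M N, (∏ t, ∏ k, invWeight (x t k)) * F (discTraj ε x) =
      ENNReal.ofReal ε ^ numPoints M N * ∑' y, F y := by
  classical
  have h1 : ∀ x : Trajectory M N, (∏ t, ∏ k, invWeight (x t k)) * F (discTraj ε x) =
      ∑' y : SliceArray M N, F y * ∏ t, ∏ k, (invWeight (x t k) *
        (if disc ε (x t k) = y t k then 1 else 0)) := by
    intro x
    rw [tsum_eq_single (discTraj ε x)]
    · simp [discTraj, mul_comm]
    · intro y hy
      obtain ⟨t, ht⟩ := Function.ne_iff.1 hy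
      obtain ⟨k, hk⟩ := Function.ne_iff.1 ht
      rw [Finset.prod_eq_zero (Finset.mem_univ t), mul_zero]
      refine Finset.prod_eq_zero (Finset.mem_univ k) ?_
      rw [if_neg, mul_zero]
      exact fun h => hk h.symm
  have hm : ∀ n : ℕ, Measurable fun u => invWeight u * (if disc ε u = n then (1 : ℝ≥0∞) else 0) :=
    fun n => measurable_invWeight.mul (Measurable.ite
      ((measurable_disc ε) (measurableSet_singleton n)) measurable_const measurable_const)
  have hm' : ∀ y : SliceArray M N, Measurable fun x : Trajectory M N => ∏ t, ∏ k,
      (invWeight (x t k) * (if disc ε (x t k) = y t k then (1 : ℝ≥0∞) else 0)) := fun y =>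
    measurable_trajectory_prod (f := fun t k u => invWeight u *
      (if disc ε u = y t k then (1 : ℝ≥0∞) else 0)) fun t k => hm (y t k)
  simp only [h1]
  rw [lintegral_tsum fun y => ((hm' y).const_mul (F y)).aemeasurable, ← ENNReal.tsum_mul_left]
  refine tsum_congr fun y => ?_
  rw [lintegral_const_mul _ (hm' y), lintegral_trajectory_prod (f := fun t k u =>
    invWeight u * (if disc ε u = y t k then (1 : ℝ≥0∞) else 0)) fun t k => hm (y t k)]
  simp only [lintegral_invWeight_fiber hε]
  rw [mul_comm]
  congr 1
  simp [numPoints, Finset.prod_pow_eq_pow_sum]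

/-! ### Domination and pointwise convergence -/

/-- The dominating function for one coordinate. -/
noncomputable def boundWeight (δ ε u : ℝ) : ℝ≥0∞ :=
  (Set.Ioo (0 : ℝ) 1).indicator (fun u => ENNReal.ofReal (Real.exp (δ * ε) * u ^ (δ - 1))) u

lemma measurable_boundWeight (δ ε : ℝ) : Measurable (boundWeight δ ε) :=
  Measurable.indicator (by fun_prop) measurableSet_Ioo

lemma lintegral_boundWeight_lt_top {δ : ℝ} (hδ : 0 < δ) (ε : ℝ) :
    ∫⁻ u, boundWeight δ ε u < ∞ := by
  unfold boundWeight
  rw [lintegral_indicator measurableSet_Ioo]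
  have h1 := integrableOn_rpow_mul_powLog_pow (κ := 0) hδ le_rfl 0
  simp only [pow_zero, mul_one] at h1
  exact (h1.const_mul (Real.exp (δ * ε))).lintegral_lt_top

lemma boundWeight_mono {δ ε ε' : ℝ} (hδ : 0 ≤ δ) (h : ε ≤ ε') (u : ℝ) :
    boundWeight δ ε u ≤ boundWeight δ ε' u := by
  unfold boundWeight
  refine Set.indicator_le_indicator' fun hu => ENNReal.ofReal_le_ofReal ?_
  have := Real.rpow_nonneg hu.1.le (δ - 1)
  gcongr

lemma invWeight_mul_exp_le {δ ε : ℝ} (hδ : 0 ≤ δ) (hε : 0 < ε) (u : ℝ) :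
    invWeight u * ENNReal.ofReal (Real.exp (-(ε * (δ * disc ε u)))) ≤ boundWeight δ ε u := by
  unfold invWeight boundWeight
  by_cases hu : u ∈ Set.Ioo (0 : ℝ) 1
  · rw [Set.indicator_of_mem hu, Set.indicator_of_mem hu,
      ← ENNReal.ofReal_mul (inv_nonneg.2 hu.1.le)]
    refine ENNReal.ofReal_le_ofReal ?_
    have h1 : -(ε * (δ * disc ε u)) ≤ δ * ε + δ * Real.log u := by
      nlinarith [mul_le_mul_of_nonneg_left (le_mul_disc (u := u) hε) hδ]
    have h2 : Real.exp (δ * Real.log u) = u ^ δ := by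
      rw [Real.rpow_def_of_pos hu.1, mul_comm]
    calc u⁻¹ * Real.exp (-(ε * (δ * disc ε u)))
        ≤ u⁻¹ * Real.exp (δ * ε + δ * Real.log u) :=
          mul_le_mul_of_nonneg_left (Real.exp_le_exp.2 h1) (inv_nonneg.2 hu.1.le)
      _ = Real.exp (δ * ε) * u ^ (δ - 1) := by
          rw [Real.exp_add, h2, Real.rpow_sub_one hu.1.ne']
          field_simp
  · simp [hu]

/-- The discretized densities are dominated by a product of integrable functions of one variable
each. -/
lemma prod_invWeight_mul_exp_le (hM : 1 ≤ M) (hN : 1 ≤ N) {α η θ : ℝ} (hη : 0 ≤ η) (hθ : 0 ≤ θ)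
    (hc : 0 < centralRate α η θ) {ε : ℝ} (hε : 0 < ε) (x : Trajectory M N)
    (hx : discTraj ε x ∈ Set.range slices) :
    (∏ t, ∏ k, invWeight (x t k)) *
        ENNReal.ofReal (Real.exp (-(ε * exponent α η θ (discTraj ε x)))) ≤
      ∏ t, ∏ k, boundWeight (centralRate α η θ / numPoints M N) ε (x t k) := by
  set δ := centralRate α η θ / numPoints M N with hδ
  have hδ0 : 0 ≤ δ := by positivity
  have h1 : Real.exp (-(ε * exponent α η θ (discTraj ε x))) ≤
      ∏ t, ∏ k, Real.exp (-(ε * (δ * (discTraj ε x t k : ℝ)))) := by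
    simp only [← Real.exp_sum]
    rw [Real.exp_le_exp]
    simp only [Finset.sum_neg_distrib, ← Finset.mul_sum]
    have := exponent_lower_bound hM hN hη hθ hc hx
    simp only [← Finset.mul_sum] at this
    have := mul_le_mul_of_nonneg_left this hε.le
    linarith
  calc _ ≤ (∏ t, ∏ k, invWeight (x t k)) *
        ENNReal.ofReal (∏ t, ∏ k, Real.exp (-(ε * (δ * (discTraj ε x t k : ℝ))))) := by gcongr
    _ = ∏ t, ∏ k, (invWeight (x t k) *
        ENNReal.ofReal (Real.exp (-(ε * (δ * (discTraj ε x t k : ℝ)))))) := by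
      rw [ENNReal.ofReal_prod_of_nonneg fun t _ =>
        Finset.prod_nonneg fun k _ => (Real.exp_pos _).le]
      simp only [ENNReal.ofReal_prod_of_nonneg fun k _ => (Real.exp_pos _).le,
        Finset.prod_mul_distrib]
    _ ≤ _ := by
      gcongr with t _ k _
      exact invWeight_mul_exp_le hδ0 hε _

lemma tendsto_mul_disc {u : ℝ} (hu : u ∈ Set.Ioo (0 : ℝ) 1) :
    Tendsto (fun ε => ε * (disc ε u : ℝ)) (𝓝[>] 0) (𝓝 (-Real.log u)) := by
  have h1 : Tendsto (fun ε : ℝ => -Real.log u - ε) (𝓝[>] 0) (𝓝 (-Real.log u)) := by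
    have : Tendsto (fun ε : ℝ => -Real.log u - ε) (𝓝 0) (𝓝 (-Real.log u - 0)) :=
      tendsto_const_nhds.sub tendsto_id
    rw [sub_zero] at this
    exact this.mono_left nhdsWithin_le_nhds
  refine tendsto_of_tendsto_of_tendsto_of_le_of_le' h1 tendsto_const_nhds ?_ ?_
  · filter_upwards [self_mem_nhdsWithin] with ε hε using le_mul_disc hε
  · filter_upwards [self_mem_nhdsWithin] with ε hε using mul_disc_le hε hu

/-- The points `exp (-ε (l + shift))` for an array of parts `l`. -/
noncomputable def scaleArray (shift : SliceArray M N) (ε : ℝ) (y : SliceArray M N) :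
    Trajectory M N :=
  fun t k => Real.exp (-(ε * ((y t k + shift t k : ℕ) : ℝ)))

/-- The trajectories all of whose points lie in `(0, 1)`. -/
def unitTraj (M N : ℕ) : Set (Trajectory M N) := {x | ∀ t k, x t k ∈ Set.Ioo (0 : ℝ) 1}

lemma tendsto_scaleArray (shift : SliceArray M N) {x : Trajectory M N} (hx : x ∈ unitTraj M N) :
    Tendsto (fun ε => scaleArray shift ε (discTraj ε x)) (𝓝[>] 0) (𝓝 x) := by
  refine tendsto_pi_nhds.2 fun t => tendsto_pi_nhds.2 fun k => ?_
  have h1 : Tendsto (fun ε : ℝ => ε * (shift t k : ℝ)) (𝓝[>] 0) (𝓝 0) := by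
    have : Tendsto (fun ε : ℝ => ε * (shift t k : ℝ)) (𝓝 0) (𝓝 (0 * (shift t k : ℝ))) :=
      tendsto_id.mul_const _
    rw [zero_mul] at this
    exact this.mono_left nhdsWithin_le_nhds
  have h2 := (Real.continuous_exp.tendsto _).comp ((tendsto_mul_disc (hx t k)).add h1).neg
  rw [add_zero, neg_neg, Real.exp_log (hx t k).1] at h2
  refine h2.congr fun ε => ?_
  simp only [Function.comp, scaleArray, discTraj]
  push_cast
  ring_nf

lemma tendsto_mul_exponent (α η θ : ℝ) {x : Trajectory M N} (hx : x ∈ unitTraj M N) :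
    Tendsto (fun ε => Real.exp (-(ε * exponent α η θ (discTraj ε x)))) (𝓝[>] 0)
      (𝓝 (∏ t, ∏ k, x t k ^ rate α η θ t)) := by
  have h1 : Tendsto (fun ε => ∑ t : Time M N, ∑ k, rate α η θ t * (ε * (disc ε (x t k) : ℝ)))
      (𝓝[>] 0) (𝓝 (∑ t : Time M N, ∑ k, rate α η θ t * (-Real.log (x t k)))) :=
    tendsto_finsetSum _ fun t _ => tendsto_finsetSum _ fun k _ =>
      (tendsto_mul_disc (hx t k)).const_mul _
  have h2 := (Real.continuous_exp.tendsto _).comp h1.neg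
  have h3 : Real.exp (-∑ t : Time M N, ∑ k, rate α η θ t * (-Real.log (x t k))) =
      ∏ t, ∏ k, x t k ^ rate α η θ t := by
    simp only [← Finset.sum_neg_distrib, Real.exp_sum]
    refine Finset.prod_congr rfl fun t _ => Finset.prod_congr rfl fun k _ => ?_
    rw [Real.rpow_def_of_pos (hx t k).1]
    ring_nf
  rw [h3] at h2
  refine h2.congr fun ε => ?_
  simp only [Function.comp, exponent, discTraj, Finset.mul_sum]
  congr 2
  refine Finset.sum_congr rfl fun t _ => Finset.sum_congr rfl fun k _ => ?_
  ring

/-- The trajectories with pairwise distinct points. -/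
def distinctTraj (M N : ℕ) : Set (Trajectory M N) :=
  {x | ∀ p q : (Σ t : Time M N, Fin (len M N t)), p ≠ q → x p.1 p.2 ≠ x q.1 q.2}

/-- Coincidences of two coordinates form a proper linear subspace. -/
lemma ae_mem_distinctTraj : ∀ᵐ x : Trajectory M N, x ∈ distinctTraj M N := by
  classical
  refine ae_all_iff.2 fun p => ae_all_iff.2 fun q => ?_
  by_cases hpq : p = q
  · exact Eventually.of_forall fun x h => absurd hpq h
  let ev : (p : Σ t : Time M N, Fin (len M N t)) → Trajectory M N →ₗ[ℝ] ℝ := fun p =>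
    (LinearMap.proj p.2 : (Fin (len M N p.1) → ℝ) →ₗ[ℝ] ℝ) ∘ₗ
      (LinearMap.proj p.1 : Trajectory M N →ₗ[ℝ] (Fin (len M N p.1) → ℝ))
  have hev : ∀ p x, ev p x = x p.1 p.2 := fun p x => rfl
  have hne : LinearMap.ker (ev p - ev q) ≠ ⊤ := by
    intro h
    have h1 : (fun t k => if (⟨t, k⟩ : Σ t : Time M N, Fin (len M N t)) = p then (1 : ℝ) else 0)
        ∈ LinearMap.ker (ev p - ev q) := by rw [h]; trivial
    rw [LinearMap.mem_ker, LinearMap.sub_apply, hev, hev] at h1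
    simp [Ne.symm hpq] at h1
  have h2 := Measure.addHaar_submodule (volume : Measure (Trajectory M N)) _ hne
  filter_upwards [compl_mem_ae_iff.2 h2] with x hx _ h3
  refine hx ?_
  rw [SetLike.mem_coe, LinearMap.mem_ker, LinearMap.sub_apply, hev, hev, h3, sub_self]

/-- The strictly ordered and interlacing trajectories. -/
def goodTraj (M N : ℕ) : Set (Trajectory M N) :=
  {x | (∀ t : Time M N, x t ∈ orderedPoints (len M N t)) ∧ ∀ s, x ∈ linkSet s}

lemma goodTraj_subset_unitTraj : goodTraj M N ⊆ unitTraj M N := fun _ hx t => (hx.1 t).2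

lemma discTraj_mem_range (hMN : M ≤ N) {ε : ℝ} (hε : 0 < ε) {x : Trajectory M N}
    (hx : x ∈ goodTraj M N) : discTraj ε x ∈ Set.range slices := by
  refine mem_range_slices hMN fun s t hst => ?_
  have h1 := hx.2 s t hst
  have hpos : ∀ t k, 0 < x t k := fun t k => (goodTraj_subset_unitTraj hx t k).1
  unfold LinkRel Interlace at h1
  unfold WeakLinkRel WeakInterlace
  split_ifs at h1 ⊢ <;> exact ⟨fun i j h => disc_anti hε (hpos _ _) (h1.2.1 i j h).le,
    fun i j h => disc_anti hε (hpos _ _) (h1.2.2 i j h).le⟩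

lemma len_succ_eq (hMN : M ≤ N) {s t : Time M N} (hst : (t : ℤ) = s + 1) :
    ((t : ℤ) ≤ 0 → len M N t = len M N s + 1) ∧
    (¬ (t : ℤ) ≤ 0 → len M N s = len M N t ∨ len M N s = len M N t + 1) := by
  have hs1 := s.2.1
  have ht2 := t.2.2
  unfold len
  constructor
  · intro h
    rw [if_pos h, if_pos (by omega)]
    omega
  · intro h
    rw [if_neg h]
    split_ifs <;> omega

/-- A trajectory with distinct points whose discretizations come from plane partitions at
arbitrarily small scales is ordered and interlacing. -/
lemma mem_goodTraj_of_frequently (hMN : M ≤ N) {x : Trajectory M N} (hx : x ∈ unitTraj M N)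
    (hd : x ∈ distinctTraj M N)
    (hf : ∃ᶠ ε in 𝓝[>] 0, discTraj ε x ∈ Set.range slices) : x ∈ goodTraj M N := by
  have hlim : ∀ t k, Tendsto (fun ε => scaleArray 0 ε (discTraj ε x) t k) (𝓝[>] 0) (𝓝 (x t k)) :=
    fun t k => tendsto_pi_nhds.1 (tendsto_pi_nhds.1 (tendsto_scaleArray 0 hx) t) k
  have key : ∀ p q : (Σ t : Time M N, Fin (len M N t)), p ≠ q →
      (∀ Λ : PlanePartition M N, slices Λ q.1 q.2 ≤ slices Λ p.1 p.2) →
      x p.1 p.2 < x q.1 q.2 := by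
    intro p q hpq h
    by_contra hlt
    have hlt : x q.1 q.2 < x p.1 p.2 := lt_of_le_of_ne (not_lt.1 hlt) (hd q p (Ne.symm hpq))
    obtain ⟨ε, ⟨⟨Λ, hΛ⟩, h1⟩, hε⟩ := ((hf.and_eventually
      ((hlim q.1 q.2).eventually_lt (hlim p.1 p.2) hlt)).and_eventually
        self_mem_nhdsWithin).exists
    have hε : 0 < ε := hε
    rw [← hΛ] at h1
    unfold scaleArray at h1
    rw [Real.exp_lt_exp, neg_lt_neg_iff, mul_lt_mul_iff_right₀ hε] at h1
    have h2 := h Λ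
    simp only [Pi.zero_apply, add_zero, Nat.cast_lt] at h1
    omega
  refine ⟨fun t => ⟨fun k l hkl => key ⟨t, k⟩ ⟨t, l⟩ (fun h => ?_) fun Λ =>
    slices_anti Λ t hkl.le, fun k => hx t k⟩, fun s t hst => ?_⟩
  · have := eq_of_heq (Sigma.mk.inj h).2
    exact hkl.ne this
  · have hne : ∀ (i : Fin (len M N s)) (j : Fin (len M N t)),
        (⟨s, i⟩ : Σ t : Time M N, Fin (len M N t)) ≠ ⟨t, j⟩ := fun i j h => by
      have := congrArg (fun p : (Σ t : Time M N, Fin (len M N t)) => (p.1 : ℤ)) h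
      simp only at this
      omega
    obtain ⟨l1, l2⟩ := len_succ_eq hMN hst
    have hw := fun Λ : PlanePartition M N => weakLinkRel_slices Λ hst
    unfold WeakLinkRel WeakInterlace at hw
    unfold LinkRel Interlace
    by_cases h : (t : ℤ) ≤ 0
    · simp only [h, if_true] at hw ⊢
      exact ⟨Or.inr (l1 h),
        fun i j hij => key ⟨t, i⟩ ⟨s, j⟩ (hne j i).symm fun Λ => (hw Λ).1 i j hij,
        fun i j hij => key ⟨s, j⟩ ⟨t, i⟩ (hne j i) fun Λ => (hw Λ).2 i j hij⟩
    · simp only [h, if_false] at hw ⊢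
      exact ⟨l2 h,
        fun i j hij => key ⟨s, i⟩ ⟨t, j⟩ (hne i j) fun Λ => (hw Λ).1 i j hij,
        fun i j hij => key ⟨t, j⟩ ⟨s, i⟩ (hne i j).symm fun Λ => (hw Λ).2 i j hij⟩

lemma chainDensity_of_mem (α η θ : ℝ) {x : Trajectory M N} (hx : x ∈ goodTraj M N) :
    chainDensity α η θ x = (∏ t, ∏ k, invWeight (x t k)) *
      ENNReal.ofReal (∏ t, ∏ k, x t k ^ rate α η θ t) := by
  have hpos : ∀ t k, 0 < x t k := fun t k => (goodTraj_subset_unitTraj hx t k).1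
  have h1 : ∀ s, link s x = 1 := fun s => Set.indicator_of_mem (hx.2 s) _
  unfold chainDensity
  simp only [h1, Finset.prod_const_one, mul_one]
  rw [ENNReal.ofReal_prod_of_nonneg fun t _ => Finset.prod_nonneg fun k _ =>
    Real.rpow_nonneg (hpos t k).le _, ← Finset.prod_mul_distrib]
  refine Finset.prod_congr rfl fun t _ => ?_
  rw [sliceWeight, Set.indicator_of_mem (hx.1 t), ENNReal.ofReal_prod_of_nonneg fun k _ =>
    Real.rpow_nonneg (hpos t k).le _, ENNReal.ofReal_prod_of_nonneg fun k _ =>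
    Real.rpow_nonneg (hpos t k).le _, ← Finset.prod_mul_distrib]
  refine Finset.prod_congr rfl fun k _ => ?_
  rw [invWeight, Set.indicator_of_mem (goodTraj_subset_unitTraj hx t k),
    ← ENNReal.ofReal_mul (inv_nonneg.2 (hpos t k).le), Real.rpow_sub_one (hpos t k).ne']
  congr 1
  field_simp

lemma chainDensity_of_notMem (α η θ : ℝ) {x : Trajectory M N} (hx : x ∉ goodTraj M N) :
    chainDensity α η θ x = 0 := by
  unfold chainDensity
  by_contra h
  rw [mul_eq_zero, not_or] at h
  have h := And.intro (Finset.prod_ne_zero_iff.1 h.1) (Finset.prod_ne_zero_iff.1 h.2)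
  refine hx ⟨fun t => ?_, fun s => ?_⟩
  · exact Set.mem_of_indicator_ne_zero (h.1 t (Finset.mem_univ t))
  · exact Set.mem_of_indicator_ne_zero (h.2 s (Finset.mem_univ s))

/-- The Riemann sums over plane partitions converge to integrals against `chainDensity`. -/
theorem tendsto_tsum_planePartition (hM : 1 ≤ M) (hMN : M ≤ N) {α η θ : ℝ} (hη : 0 ≤ η)
    (hθ : 0 ≤ θ) (hc : 0 < centralRate α η θ) (shift : SliceArray M N)
    {f : Trajectory M N → ℝ≥0∞} (hf : Continuous f) {K : ℝ≥0∞} (hK : K ≠ ∞) (hfK : ∀ x, f x ≤ K) :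
    Tendsto (fun ε => ENNReal.ofReal ε ^ numPoints M N * ∑' Λ : PlanePartition M N,
        ENNReal.ofReal (Real.exp (-(ε * exponent α η θ (slices Λ)))) *
          f (scaleArray shift ε (slices Λ)))
      (𝓝[>] 0) (𝓝 (∫⁻ x, chainDensity α η θ x * f x)) := by
  classical
  set δ := centralRate α η θ / numPoints M N with hδ
  let G : ℝ → SliceArray M N → ℝ≥0∞ := fun ε => (Set.range slices).indicator fun y =>
    ENNReal.ofReal (Real.exp (-(ε * exponent α η θ y))) * f (scaleArray shift ε y)
  have hsum : ∀ ε : ℝ, 0 < ε → ∫⁻ x : Trajectory M N, (∏ t, ∏ k, invWeight (x t k)) *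
      G ε (discTraj ε x) = ENNReal.ofReal ε ^ numPoints M N * ∑' Λ : PlanePartition M N,
        ENNReal.ofReal (Real.exp (-(ε * exponent α η θ (slices Λ)))) *
          f (scaleArray shift ε (slices Λ)) := by
    intro ε hε
    rw [lintegral_discTraj hε, ← tsum_subtype, tsum_range (fun y : SliceArray M N =>
      ENNReal.ofReal (Real.exp (-(ε * exponent α η θ y))) * f (scaleArray shift ε y))
      slices_injective]
  have hGm : ∀ ε, Measurable fun x : Trajectory M N => (∏ t, ∏ k, invWeight (x t k)) *
      G ε (discTraj ε x) := fun ε =>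
    (measurable_trajectory_prod fun _ _ => measurable_invWeight).mul
      ((measurable_of_countable (G ε)).comp (measurable_discTraj ε))
  have hn := numPoints_pos hM (hM.trans hMN)
  have hδ0 : 0 < δ := by positivity
  -- Dominated convergence: off the null set of trajectories with coincidences, membership of the
  -- discretization in the range of `slices` is eventually decided by membership in `goodTraj`.
  have hlim : Tendsto (fun ε => ∫⁻ x : Trajectory M N, (∏ t, ∏ k, invWeight (x t k)) *
      G ε (discTraj ε x)) (𝓝[>] 0) (𝓝 (∫⁻ x, chainDensity α η θ x * f x)) := by
    refine tendsto_lintegral_filter_of_dominated_convergence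
      (fun x : Trajectory M N => (∏ t, ∏ k, boundWeight δ 1 (x t k)) * K)
      (Eventually.of_forall hGm) ?_ ?_ ?_
    · filter_upwards [Ioc_mem_nhdsGT one_pos] with ε hε
      refine Eventually.of_forall fun x => ?_
      by_cases hx : discTraj ε x ∈ Set.range slices
      · simp only [G, Set.indicator_of_mem hx]
        rw [← mul_assoc]
        refine mul_le_mul' ((prod_invWeight_mul_exp_le hM (hM.trans hMN) hη hθ hc hε.1 x hx).trans
          ?_) (hfK _)
        gcongr with t _ k _
        exact boundWeight_mono hδ0.le hε.2 _
      · simp only [G, Set.indicator_of_notMem hx, mul_zero]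
        exact zero_le
    · rw [lintegral_mul_const _ (measurable_trajectory_prod fun _ _ => measurable_boundWeight δ 1),
        lintegral_trajectory_prod fun _ _ => measurable_boundWeight δ 1]
      exact ENNReal.mul_ne_top (ENNReal.prod_ne_top fun t _ => ENNReal.prod_ne_top fun k _ =>
        (lintegral_boundWeight_lt_top hδ0 1).ne) hK
    · filter_upwards [ae_mem_distinctTraj] with x hd
      by_cases hx : x ∈ unitTraj M N
      · by_cases hg : x ∈ goodTraj M N
        · have h1 : Tendsto (fun ε => (∏ t, ∏ k, invWeight (x t k)) *
              (ENNReal.ofReal (Real.exp (-(ε * exponent α η θ (discTraj ε x)))) *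
                f (scaleArray shift ε (discTraj ε x)))) (𝓝[>] 0)
              (𝓝 ((∏ t, ∏ k, invWeight (x t k)) *
                (ENNReal.ofReal (∏ t, ∏ k, x t k ^ rate α η θ t) * f x))) := by
            have e1 := ENNReal.tendsto_ofReal (tendsto_mul_exponent α η θ hx)
            have e2 := (hf.tendsto x).comp (tendsto_scaleArray shift hx)
            refine ENNReal.Tendsto.const_mul (ENNReal.Tendsto.mul e1
              (Or.inr (ne_top_of_le_ne_top hK (hfK x))) e2 (Or.inr ENNReal.ofReal_ne_top))
              (Or.inr ?_)
            refine ENNReal.prod_ne_top fun t _ => ENNReal.prod_ne_top fun k _ => ?_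
            rw [invWeight, Set.indicator_of_mem (hx t k)]
            exact ENNReal.ofReal_ne_top
          rw [chainDensity_of_mem α η θ hg, mul_assoc]
          refine h1.congr' ?_
          filter_upwards [self_mem_nhdsWithin] with ε hε
          simp only [G, Set.indicator_of_mem (discTraj_mem_range hMN hε hg)]
        · rw [chainDensity_of_notMem α η θ hg, zero_mul]
          have h1 : ∀ᶠ ε in 𝓝[>] 0, discTraj ε x ∉ Set.range slices :=
            not_frequently.1 fun h => hg (mem_goodTraj_of_frequently hMN hx hd h)
          refine tendsto_const_nhds.congr' ?_
          filter_upwards [h1] with ε hε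
          simp only [G, Set.indicator_of_notMem hε, mul_zero]
      · rw [chainDensity_of_notMem α η θ (mt (fun h => goodTraj_subset_unitTraj h) hx), zero_mul]
        have h1 : ∏ t, ∏ k, invWeight (x t k) = 0 := by
          unfold unitTraj at hx
          simp only [Set.mem_ofPred_eq, not_forall] at hx
          obtain ⟨t, k, hx⟩ := hx
          exact Finset.prod_eq_zero (Finset.mem_univ t) (Finset.prod_eq_zero (Finset.mem_univ k)
            (Set.indicator_of_notMem hx _))
        simp only [h1, zero_mul]
        exact tendsto_const_nhds
  refine hlim.congr' ?_
  filter_upwards [self_mem_nhdsWithin] with ε hε using hsum ε hε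

/-- The partition function of the plane partitions is finite. -/
lemma tsum_exp_exponent_ne_top (hM : 1 ≤ M) (hMN : M ≤ N) {α η θ : ℝ} (hη : 0 ≤ η)
    (hθ : 0 ≤ θ) (hc : 0 < centralRate α η θ) {ε : ℝ} (hε : 0 < ε) :
    ∑' Λ : PlanePartition M N,
      ENNReal.ofReal (Real.exp (-(ε * exponent α η θ (slices Λ)))) ≠ ∞ := by
  set δ := centralRate α η θ / numPoints M N with hδ
  have hn := numPoints_pos hM (hM.trans hMN)
  have hδ0 : 0 < δ := by positivity
  have h1 := lintegral_discTraj hε ((Set.range (slices (M := M) (N := N))).indicator fun y =>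
    ENNReal.ofReal (Real.exp (-(ε * exponent α η θ y))))
  rw [← tsum_subtype, tsum_range (fun y : SliceArray M N =>
      ENNReal.ofReal (Real.exp (-(ε * exponent α η θ y)))) slices_injective] at h1
  have h2 : ∫⁻ x : Trajectory M N, (∏ t, ∏ k, invWeight (x t k)) *
      (Set.range (slices (M := M) (N := N))).indicator (fun y =>
        ENNReal.ofReal (Real.exp (-(ε * exponent α η θ y)))) (discTraj ε x) < ∞ := by
    refine lt_of_le_of_lt (lintegral_mono fun x => ?_)
      (b := ∫⁻ x : Trajectory M N, ∏ t, ∏ k, boundWeight δ ε (x t k)) ?_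
    · by_cases hx : discTraj ε x ∈ Set.range slices
      · rw [Set.indicator_of_mem hx]
        exact prod_invWeight_mul_exp_le hM (hM.trans hMN) hη hθ hc hε x hx
      · rw [Set.indicator_of_notMem hx, mul_zero]
        exact zero_le
    · rw [lintegral_trajectory_prod fun _ _ => measurable_boundWeight δ ε]
      exact ENNReal.prod_lt_top fun t _ => ENNReal.prod_lt_top fun k _ =>
        lintegral_boundWeight_lt_top hδ0 ε
  intro h
  rw [h1, h, ENNReal.mul_top (pow_ne_zero _ (ENNReal.ofReal_pos.2 hε).ne')] at h2
  exact lt_irrefl _ h2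

end Discretization

/-! ### The limiting process -/

section Limit

variable {M N : ℕ}

lemma lintegral_chainDensity_ne_top (hM : 1 ≤ M) (hMN : M ≤ N) {α η θ : ℝ} (hη : 0 ≤ η)
    (hθ : 0 ≤ θ) (hc : 0 < centralRate α η θ) :
    ∫⁻ x : Trajectory M N, chainDensity α η θ x ≠ ∞ := by
  set δ := centralRate α η θ / numPoints M N with hδ
  have hn := numPoints_pos hM (hM.trans hMN)
  have hδ0 : 0 < δ := by positivity
  refine ne_top_of_le_ne_top (b := ∫⁻ x : Trajectory M N, ∏ t, ∏ k, boundWeight δ 1 (x t k)) ?_ ?_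
  · rw [lintegral_trajectory_prod fun _ _ => measurable_boundWeight δ 1]
    exact ENNReal.prod_ne_top fun t _ => ENNReal.prod_ne_top fun k _ =>
      (lintegral_boundWeight_lt_top hδ0 1).ne
  · refine lintegral_mono fun x => ?_
    by_cases hx : x ∈ goodTraj M N
    · -- pass to the limit in the bound for the discretizations
      have hu := goodTraj_subset_unitTraj hx
      rw [chainDensity_of_mem α η θ hx]
      have h1 := ENNReal.Tendsto.const_mul (a := ∏ t, ∏ k, invWeight (x t k))
        (ENNReal.tendsto_ofReal (tendsto_mul_exponent α η θ hu)) (Or.inr <|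
          ENNReal.prod_ne_top fun t _ => ENNReal.prod_ne_top fun k _ => by
            rw [invWeight, Set.indicator_of_mem (hu t k)]
            exact ENNReal.ofReal_ne_top)
      refine le_of_tendsto h1 ?_
      filter_upwards [Ioc_mem_nhdsGT one_pos] with ε hε
      refine (prod_invWeight_mul_exp_le hM (hM.trans hMN) hη hθ hc hε.1 x
        (discTraj_mem_range hMN hε.1 hx)).trans ?_
      gcongr with t _ k _
      exact boundWeight_mono hδ0.le hε.2 _
    · rw [chainDensity_of_notMem α η θ hx]
      exact zero_le

lemma isOpen_orderedPoints (n : ℕ) : IsOpen (orderedPoints n) := by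
  have h : orderedPoints n = (⋂ i, ⋂ j, ⋂ (_ : i < j), {x : Fin n → ℝ | x i < x j}) ∩
      ⋂ i, {x : Fin n → ℝ | x i ∈ Set.Ioo (0 : ℝ) 1} := by
    ext x
    simp [orderedPoints, StrictMono]
  rw [h]
  refine IsOpen.inter ?_ ?_
  · refine isOpen_iInter_of_finite fun i => isOpen_iInter_of_finite fun j =>
      isOpen_iInter_of_finite fun _ => isOpen_lt (continuous_apply i) (continuous_apply j)
  · exact isOpen_iInter_of_finite fun i => isOpen_Ioo.preimage (continuous_apply i)

lemma nonempty_orderedPoints (n : ℕ) : (orderedPoints n).Nonempty := by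
  refine ⟨fun i => ((i : ℕ) + 1 : ℝ) / (n + 1), fun i j hij => ?_, fun i => ⟨by positivity, ?_⟩⟩
  · have : ((i : ℕ) : ℝ) < (j : ℕ) := by exact_mod_cast hij
    simp only
    gcongr
  · rw [div_lt_one (by positivity)]
    have : ((i : ℕ) : ℝ) < n := by exact_mod_cast i.2
    linarith

lemma weightC_pos {α η θ : ℝ} (hη : 0 ≤ η) (hθ : 0 ≤ θ) (t : ℤ) {u : ℝ}
    (hu : u ∈ Set.Ioo (0 : ℝ) 1) : 0 < weightC M N α η θ t u := by
  have h1 := powDiff_pos hη hu.1 hu.2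
  have h2 := powDiff_pos hθ hu.1 hu.2
  unfold weightC
  split_ifs <;> exact mul_pos (Real.rpow_pos_of_pos hu.1 _) (pow_pos (by assumption) _)

lemma mbDensity_pos {α η θ : ℝ} (hη : 0 ≤ η) (hθ : 0 ≤ θ) (t : ℤ) {x : Fin (len M N t) → ℝ}
    (hx : x ∈ orderedPoints (len M N t)) : 0 < mbDensity M N α η θ t x := by
  refine mul_pos (Finset.prod_pos fun i _ => Finset.prod_pos fun j hj => ?_)
    (Finset.prod_pos fun i _ => weightC_pos hη hθ t (hx.2 i))
  have h := hx.1 (Finset.mem_Ioi.1 hj)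
  exact mul_pos (powDiff_pos hη (hx.2 i).1 h) (powDiff_pos hθ (hx.2 i).1 h)

lemma lintegral_chainDensity_ne_zero (hM : 1 ≤ M) (hMN : M ≤ N) {α η θ : ℝ} (hη : 0 ≤ η)
    (hθ : 0 ≤ θ) (hc : 0 < centralRate α η θ) :
    ∫⁻ x : Trajectory M N, chainDensity α η θ x ≠ 0 := by
  let t : Time M N := ⟨0, by omega, by omega⟩
  obtain ⟨C, hC, h⟩ := exists_lintegral_mul_chainDensity hM hMN hη hθ hc t
  have h1 := h (fun _ => 1) measurable_const
  simp only [one_mul, lintegral_one] at h1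
  rw [h1, mul_ne_zero_iff]
  refine ⟨(ENNReal.ofReal_pos.2 hC).ne', fun h0 => ?_⟩
  rw [mbMeasure, withDensity_apply _ MeasurableSet.univ, Measure.restrict_univ] at h0
  refine (isOpen_orderedPoints (len M N t)).measure_ne_zero volume (nonempty_orderedPoints _) ?_
  rw [lintegral_eq_zero_iff (measurable_mbDensity t).ennreal_ofReal] at h0
  rw [← Measure.restrict_eq_zero, ← ae_eq_bot, ← Filter.empty_mem_iff_bot]
  filter_upwards [h0, ae_restrict_mem (measurableSet_orderedPoints _)] with x hx hx'
  exact (ENNReal.ofReal_pos.2 (mbDensity_pos hη hθ t hx')).ne' hx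

/-- The law of the limiting process. -/
noncomputable def chainLaw (M N : ℕ) (α η θ : ℝ) : Measure (Trajectory M N) :=
  (∫⁻ x : Trajectory M N, chainDensity α η θ x)⁻¹ • volume.withDensity (chainDensity α η θ)

lemma isProbabilityMeasure_chainLaw (hM : 1 ≤ M) (hMN : M ≤ N) {α η θ : ℝ} (hη : 0 ≤ η)
    (hθ : 0 ≤ θ) (hc : 0 < centralRate α η θ) : IsProbabilityMeasure (chainLaw M N α η θ) := by
  refine ⟨?_⟩
  rw [chainLaw, Measure.smul_apply, withDensity_apply _ MeasurableSet.univ, setLIntegral_univ,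
    smul_eq_mul]
  exact ENNReal.inv_mul_cancel (lintegral_chainDensity_ne_zero hM hMN hη hθ hc)
    (lintegral_chainDensity_ne_top hM hMN hη hθ hc)

lemma lintegral_chainLaw (α η θ : ℝ) {f : Trajectory M N → ℝ≥0∞} (hf : Measurable f) :
    ∫⁻ x, f x ∂(chainLaw M N α η θ) =
      (∫⁻ x : Trajectory M N, chainDensity α η θ x)⁻¹ * ∫⁻ x, chainDensity α η θ x * f x := by
  rw [chainLaw, lintegral_smul_measure,
    lintegral_withDensity_eq_lintegral_mul _ (measurable_chainDensity α η θ) hf]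
  rfl

lemma ae_chainLaw_mem_goodTraj (α η θ : ℝ) : ∀ᵐ x ∂(chainLaw M N α η θ), x ∈ goodTraj M N := by
  refine Measure.ae_smul_measure ?_ _
  rw [ae_withDensity_iff (measurable_chainDensity α η θ)]
  exact Eventually.of_forall fun x h => by
    by_contra hx
    exact h (chainDensity_of_notMem α η θ hx)

/-- The conditions at the two end times hold because the slices there have one point. -/
lemma interlacingTrajectory_of_mem_goodTraj (hM : 1 ≤ M) (hMN : M ≤ N) {x : Trajectory M N}
    (hx : x ∈ goodTraj M N) : InterlacingTrajectory x := by
  refine ⟨fun t ht => ?_, fun s t hst ht => ?_, fun s t hst hs => ?_, fun t ht => ?_⟩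
  · exact ⟨Or.inr (len_first hM ht), fun i j => Fin.elim0 j, fun i j => Fin.elim0 j⟩
  · have := hx.2 s t hst
    rwa [LinkRel, if_pos ht] at this
  · have := hx.2 s t hst
    rwa [LinkRel, if_neg (by omega)] at this
  · exact ⟨Or.inr (len_last hM hMN ht), fun i j => Fin.elim0 j, fun i j => Fin.elim0 j⟩

lemma exists_map_chainLaw (hM : 1 ≤ M) (hMN : M ≤ N) {α η θ : ℝ} (hη : 0 ≤ η)
    (hθ : 0 ≤ θ) (hc : 0 < centralRate α η θ) (t : Time M N) :
    ∃ Z : ℝ, 0 < Z ∧ (chainLaw M N α η θ).map (fun x => x t) =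
      (ENNReal.ofReal Z)⁻¹ • mbMeasure M N α η θ t := by
  obtain ⟨C, hC, h⟩ := exists_lintegral_mul_chainDensity hM hMN hη hθ hc t
  set I := ∫⁻ x : Trajectory M N, chainDensity α η θ x with hI
  have hI0 : I ≠ 0 := lintegral_chainDensity_ne_zero hM hMN hη hθ hc
  have hI1 : I ≠ ∞ := lintegral_chainDensity_ne_top hM hMN hη hθ hc
  have hIpos : 0 < I.toReal := ENNReal.toReal_pos hI0 hI1
  refine ⟨I.toReal / C, div_pos hIpos hC, Measure.ext fun s hs => ?_⟩
  have h1 := h (s.indicator 1) (measurable_one.indicator hs)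
  rw [lintegral_indicator_one hs] at h1
  have h2 := lintegral_chainLaw α η θ (f := fun x : Trajectory M N => s.indicator 1 (x t))
    ((measurable_one.indicator hs).comp (measurable_pi_apply t))
  simp only [mul_comm (chainDensity α η θ _)] at h2
  rw [h1, ← lintegral_map (f := s.indicator 1) (measurable_one.indicator hs)
    (measurable_pi_apply t), lintegral_indicator_one hs] at h2
  rw [h2, Measure.smul_apply, smul_eq_mul, ← mul_assoc, ENNReal.ofReal_div_of_pos hC,
    ENNReal.ofReal_toReal hI1, ENNReal.inv_div (Or.inl ENNReal.ofReal_ne_top)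
      (Or.inl (ENNReal.ofReal_pos.2 hC).ne'), ENNReal.div_eq_inv_mul]

/-! ### The discrete measures and their convergence -/

/-- The plane partition measures exist; the values `P ε` with `ε ≤ 0` are arbitrary. -/
lemma exists_planePartitionLaw (hM : 1 ≤ M) (hMN : M ≤ N) {α η θ : ℝ} (hη : 0 ≤ η)
    (hθ : 0 ≤ θ) (hc : 0 < centralRate α η θ) :
    ∃ P : ℝ → PMF (PlanePartition M N), ∀ ε : ℝ, 0 < ε →
      IsPlanePartitionLaw (Real.exp (-ε)) (Real.exp (-(α * ε))) η θ (P ε) := by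
  let Λ₀ : PlanePartition M N := ⟨fun _ _ => 0, fun _ _ => le_rfl, fun _ _ => le_rfl,
    fun _ _ _ => rfl⟩
  have h : ∀ ε : ℝ, 0 < ε → ∃ P : PMF (PlanePartition M N),
      IsPlanePartitionLaw (Real.exp (-ε)) (Real.exp (-(α * ε))) η θ P := by
    intro ε hε
    have h1 := tsum_exp_exponent_ne_top hM hMN hη hθ hc hε
    simp only [← weight_eq_exp hM (hM.trans hMN)] at h1
    have h0 : ∑' Λ : PlanePartition M N,
        ENNReal.ofReal (Λ.weight (Real.exp (-ε)) (Real.exp (-(α * ε))) η θ) ≠ 0 := by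
      intro h0
      have := ENNReal.tsum_eq_zero.1 h0 Λ₀
      rw [weight_eq_exp hM (hM.trans hMN), ENNReal.ofReal_eq_zero] at this
      exact absurd (Real.exp_pos _) (not_lt.2 this)
    exact ⟨PMF.normalize _ h0 h1, fun Λ => by rw [PMF.normalize_apply]; rfl⟩
  have : Nonempty (PMF (PlanePartition M N)) := ⟨PMF.pure Λ₀⟩
  choose! P hP using h
  exact ⟨P, hP⟩

lemma lintegral_planePartitionLaw {q a η θ : ℝ} {P : PMF (PlanePartition M N)}
    (hP : IsPlanePartitionLaw q a η θ P) (f : PlanePartition M N → ℝ≥0∞) :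
    ∫⁻ Λ, f Λ ∂P.toMeasure = (∑' Λ, ENNReal.ofReal (Λ.weight q a η θ) * f Λ) /
      ∑' Λ : PlanePartition M N, ENNReal.ofReal (Λ.weight q a η θ) := by
  rw [lintegral_countable', ENNReal.div_eq_inv_mul, ← ENNReal.tsum_mul_left]
  refine tsum_congr fun Λ => ?_
  rw [PMF.toMeasure_apply_singleton _ _ (measurableSet_singleton Λ), hP Λ, ENNReal.div_eq_inv_mul]
  ring

/-- Convergence of the finite-dimensional distributions of the rescaled slices, whose parts may be
shifted by any fixed amounts. -/
lemma tendstoInDistribution_slices (hM : 1 ≤ M) (hMN : M ≤ N) {α η θ : ℝ} (hη : 0 ≤ η)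
    (hθ : 0 ≤ θ) (hc : 0 < centralRate α η θ) {P : ℝ → PMF (PlanePartition M N)}
    (hP : ∀ ε : ℝ, 0 < ε →
      IsPlanePartitionLaw (Real.exp (-ε)) (Real.exp (-(α * ε))) η θ (P ε))
    [IsProbabilityMeasure (chainLaw M N α η θ)] (shift : SliceArray M N)
    {n : ℕ} (τ : Fin n → Time M N) :
    TendstoInDistribution
      (fun (ε : ℝ) (Λ : PlanePartition M N) (r : Fin n) => scaleArray shift ε (slices Λ) (τ r))
      (𝓝[>] 0) (fun (x : Trajectory M N) (r : Fin n) => x (τ r))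
      (fun ε => (P ε).toMeasure) (chainLaw M N α η θ) where
  forall_aemeasurable ε := (measurable_of_countable _).aemeasurable
  aemeasurable_limit := (measurable_pi_lambda _ fun r => measurable_pi_apply (τ r)).aemeasurable
  tendsto := by
    refine ProbabilityMeasure.tendsto_iff_forall_lintegral_tendsto.2 fun f => ?_
    have hτ : Continuous fun (x : Trajectory M N) (r : Fin n) => x (τ r) :=
      continuous_pi fun r => continuous_apply (τ r)
    have hfc : Continuous fun y => (f y : ℝ≥0∞) := ENNReal.continuous_coe.comp f.continuous
    obtain ⟨K, hK⟩ : ∃ K : NNReal, ∀ y, f y ≤ K :=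
      ⟨_, fun y => BoundedContinuousFunction.NNReal.upper_bound f y⟩
    have h1 := tendsto_tsum_planePartition hM hMN hη hθ hc shift (hfc.comp hτ)
      (ENNReal.coe_ne_top (r := K)) fun x => ENNReal.coe_le_coe.2 (hK _)
    have h2 := tendsto_tsum_planePartition hM hMN hη hθ hc shift (continuous_const (y := 1))
      ENNReal.one_ne_top fun x => le_rfl
    simp only [mul_one] at h2
    have h3 := ENNReal.Tendsto.div h1 (Or.inr (lintegral_chainDensity_ne_zero hM hMN hη hθ hc)) h2
      (Or.inl (lintegral_chainDensity_ne_top hM hMN hη hθ hc))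
    simp only [ProbabilityMeasure.coe_mk]
    rw [lintegral_map hfc.measurable hτ.measurable, lintegral_chainLaw α η θ
      (f := fun x => (f fun r => x (τ r) : ℝ≥0∞)) (hfc.measurable.comp hτ.measurable),
      ← ENNReal.div_eq_inv_mul]
    refine h3.congr' ?_
    filter_upwards [self_mem_nhdsWithin] with ε hε
    have hε : 0 < ε := hε
    rw [lintegral_map hfc.measurable (measurable_of_countable _),
      lintegral_planePartitionLaw (hP ε hε)]
    simp only [weight_eq_exp hM (hM.trans hMN)]
    exact ENNReal.mul_div_mul_left _ _ (pow_ne_zero _ (ENNReal.ofReal_pos.2 hε).ne')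
      (ENNReal.pow_ne_top ENNReal.ofReal_ne_top)

end Limit

end MuttalibBorodin

theorem theorem3 (M N : ℕ) (hM : 1 ≤ M) (hMN : M ≤ N)
    (α η θ : ℝ) (hα : 0 ≤ α) (hη : 0 ≤ η) (hθ : 0 ≤ θ)
    (hne : ¬ (α = 0 ∧ η = 0 ∧ θ = 0)) :
    ∃ P : ℝ → PMF (PlanePartition M N),
      (∀ ε : ℝ, 0 < ε →
        IsPlanePartitionLaw (Real.exp (-ε)) (Real.exp (-(α * ε))) η θ (P ε)) ∧
      ∃ μ : ProbabilityMeasure (Trajectory M N),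
        (∀ (n : ℕ) (τ : Fin n → Time M N),
          TendstoInDistribution
            (fun (ε : ℝ) (Λ : PlanePartition M N) (r : Fin n) => Λ.scaled ε (τ r))
            (𝓝[>] 0) (fun (x : Trajectory M N) (r : Fin n) => x (τ r))
            (fun ε => (P ε).toMeasure) (μ : Measure (Trajectory M N)) ∧
          TendstoInDistribution
            (fun (ε : ℝ) (Λ : PlanePartition M N) (r : Fin n) => Λ.scaledPos ε (τ r))
            (𝓝[>] 0) (fun (x : Trajectory M N) (r : Fin n) => x (τ r))
            (fun ε => (P ε).toMeasure) (μ : Measure (Trajectory M N))) ∧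
        (∀ᵐ x ∂(μ : Measure (Trajectory M N)),
          (∀ t : Time M N, x t ∈ orderedPoints (len M N t)) ∧ InterlacingTrajectory x) ∧
        (∀ t : Time M N, ∃ Z : ℝ, 0 < Z ∧
          (μ : Measure (Trajectory M N)).map (fun x => x t) =
            (ENNReal.ofReal Z)⁻¹ • mbMeasure M N α η θ t) := by
  have hc := centralRate_pos hα hη hθ hne
  obtain ⟨P, hP⟩ := exists_planePartitionLaw (α := α) hM hMN hη hθ hc
  have hprob := isProbabilityMeasure_chainLaw hM hMN hη hθ hc
  refine ⟨P, hP, ⟨chainLaw M N α η θ, hprob⟩, fun n τ => ⟨?_, ?_⟩, ?_, fun t => ?_⟩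
  · exact tendstoInDistribution_slices hM hMN hη hθ hc hP 0 τ
  · exact tendstoInDistribution_slices hM hMN hη hθ hc hP (fun _ k => M - (k + 1)) τ
  · filter_upwards [ae_chainLaw_mem_goodTraj α η θ] with x hx
    exact ⟨hx.1, interlacingTrajectory_of_mem_goodTraj hM hMN hx⟩
  · exact exists_map_chainLaw hM hMN hη hθ hc t
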